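/- Let $\nu$ be a (nonnegative) Borel measure on $\mathbb R$ such that every polynomial is $\nu$-integrable and $\nu$ is not concentrated on a finite set (for example $\nu=\rho(t)\,dt$ on an interval, with $\rho\ge 0$, $\int\rho>0$, and all moments finite). Let $\phi_0,\phi_1,\dots$ be orthonormal polynomials for $\nu$, i.e. real polynomials with $\deg\phi_k=k$ and $\int\phi_j\phi_k\,d\nu=\delta_{jk}$ (they are obtained from $1,t,t^2,\dots$ by the Gram–Schmidt process and are unique up to signs). Let $W_n\subset L^2(\mathbb R,\nu)$ be the span of $1,t,\dots,t^{n-1}$, let $\Lambda_n$ be the orthogonal projection onto $W_n$, and let $\tilde t$ be the operator of multiplication by $t$. Notation. Let $n\ge 1$, $d(k)=k(k+1)/2$, and let $M(n)$ be the space of complex $n\times n$ matrices. For $y\in M(n)$ and $1\le m\le n$ let $y_m$ be the upper left $m\times m$ corner of $y$, and let $E_y(m)$ be the $m$-tuple of eigenvalues of $y_m$, with multiplicity, in increasing lexicographic order (real part first, then imaginary part). Let $\Phi_n:M(n)\to\mathbb C^{d(n)}$ be the map whose coordinates are $f_{k,m}(y)$, $1\le k\le m\le n$, where $\det(\lambda-y_m)=\lambda^m+\sum_{k=1}^m(-1)^{m-k+1}f_{k,m}(y)\lambda^{k-1}$.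 For $c\in\mathbb C^{d(n)}$ put $M_c(n)=\Phi_n^{-1}(c)$, let $M_c^{(sym)}(n)$ be the set of symmetric matrices in $M_c(n)$, and let $\mu_{1\,m}(c),\dots,\mu_{m\,m}(c)$ be the roots, in increasing lexicographic order, of the degree $m$ monic polynomial $\lambda^m+\sum_{k=1}^m(-1)^{m-k+1}c_{k,m}\lambda^{k-1}$ determined by $c$. Say that $c$ is interlacing if all $\mu_{k\,m}(c)$ are real and $\mu_{1\,m+1}<\mu_{1\,m}<\mu_{2\,m+1}<\cdots<\mu_{m\,m}<\mu_{m+1\,m+1}$ for $1\le m<n$. A matrix $y$ is Jacobi if $y_{ij}=0$ for $|i-j|>1$ and $y_{ij}\ne0$ for $|i-j|=1$; it has positive adjacent diagonals if $y_{ij}>0$ for $|i-j|=1$. **Theorem.** Let $x\in M(n)$ be the matrix of $\Lambda_n\tilde t|_{W_n}$ in the basis $\phi_0,\dots,\phi_{n-1}$ and let $c=\Phi_n(x)$. 1. $c$ is interlacing, $x$ is a real matrix in $M_c^{(sym)}(n)$, and $x$ is Jacobi. 2. $M_c^{(sym)}(n)$ has exactly $2^{d(n-1)}$ elements, and exactly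 $2^{n-1}$ of them are Jacobi. The Jacobi matrices in $M_c^{(sym)}(n)$ are exactly the matrices of $\Lambda_n\tilde t|_{W_n}$ in the bases $\varepsilon_0\phi_0,\dots,\varepsilon_{n-1}\phi_{n-1}$ with $\varepsilon_k\in\{1,-1\}$; each of them arises from exactly one choice of signs with $\varepsilon_0=1$. 3. For $1\le m\le n$ the characteristic polynomial of $x_m$ is the monic polynomial $a_m^{-1}\phi_m$, where $a_m$ is the leading coefficient of $\phi_m$. In particular the set of numbers in $E_x(m)$ is the set of zeros of $\phi_m$. 4. Suppose that the $\phi_k$ are normalized to have positive leading coefficients. Then $x$ has positive adjacent diagonals. It is the only Jacobi matrix in $M_c^{(sym)}(n)$ with positive adjacent diagonals. Moreover it is the only symmetric Jacobi matrix $y\in M(n)$ with positive adjacent diagonals such that, for every $1\le m\le n$, the set of numbers in $E_y(m)$ is the set of zeros of $\phi_m$. -/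

import Mathlib

open MeasureTheory Polynomial

noncomputable section

namespace OrthoJacobi

/-! ### Cutoffs, eigenvalue tuples, and the map `Φ_n` -/

/-- The cutoff `x_m`: the upper left `m × m` corner of `x`. -/
def cutoff {n : ℕ} (x : Matrix (Fin n) (Fin n) ℂ) (m : ℕ) (hm : m ≤ n) :
    Matrix (Fin m) (Fin m) ℂ :=
  x.submatrix (Fin.castLE hm) (Fin.castLE hm)

/-- The roots of a complex polynomial, with multiplicity, listed in increasing lexicographic order
(real part first, then imaginary part). -/
def orderedRoots (p : ℂ[X]) : List ℂ :=
  ((p.roots.map fun z => (toLex (z.re, z.im) : ℝ ×ₗ ℝ)).sort (· ≤ ·)).map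
    fun u => ⟨(ofLex u).1, (ofLex u).2⟩

theorem length_orderedRoots (p : ℂ[X]) : (orderedRoots p).length = p.natDegree := by
  simp [orderedRoots, (IsAlgClosed.splits p).natDegree_eq_card_roots]

/-- `E_x(m)`: the increasing tuple of eigenvalues of `x_m`, with multiplicity as roots of the
characteristic polynomial. -/
def eigTuple {n : ℕ} (x : Matrix (Fin n) (Fin n) ℂ) (m : ℕ) (hm : m ≤ n) : List ℂ :=
  orderedRoots (cutoff x m hm).charpoly

/-- The index set of the coordinates of `ℂ^{d(n)}`, `d(n) = n(n+1)/2`: pairs `1 ≤ k ≤ m ≤ n`.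
The pair `(m, k)` is stored as `⟨m - 1, k - 1⟩` and stands for the coordinate
number `d(m - 1) + k`. -/
abbrev ParamIdx (n : ℕ) : Type := (m : Fin n) × Fin ((m : ℕ) + 1)

/-- `Φ_n : M(n) → ℂ^{d(n)}`. The coordinate of index `(m, k)` is `f_{k,m}(x)`, where
`det (λ - x_m) = λ^m + ∑_{k=1}^m (-1)^{m-k+1} f_{k,m}(x) λ^{k-1}`; it is the elementary symmetric
function of degree `m - k + 1` of the eigenvalues of `x_m`. -/
def Phi {n : ℕ} (x : Matrix (Fin n) (Fin n) ℂ) : ParamIdx n → ℂ := fun i =>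
  (-1) ^ ((i.1 : ℕ) + 1 - (i.2 : ℕ)) * (cutoff x ((i.1 : ℕ) + 1) i.1.isLt).charpoly.coeff (i.2 : ℕ)

/-- The fibre `M_c(n)` of `Φ_n` over `c`. -/
def fiber {n : ℕ} (c : ParamIdx n → ℂ) : Set (Matrix (Fin n) (Fin n) ℂ) := {x | Phi x = c}

/-- `M_c^{(sym)}(n)`: the (complex) symmetric matrices in `M_c(n)`. -/
def fiberSymm {n : ℕ} (c : ParamIdx n → ℂ) : Set (Matrix (Fin n) (Fin n) ℂ) :=
  {x | x ∈ fiber c ∧ x.IsSymm}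

/-- For `c ∈ ℂ^{d(n)}` and the size `m + 1`, the monic polynomial of degree `m + 1` with the
coefficients prescribed by `c`. -/
def paramPoly {n : ℕ} (c : ParamIdx n → ℂ) (m : Fin n) : ℂ[X] :=
  X ^ ((m : ℕ) + 1) +
    ∑ k : Fin ((m : ℕ) + 1), C ((-1) ^ ((m : ℕ) + 1 - (k : ℕ)) * c ⟨m, k⟩) * X ^ (k : ℕ)

theorem natDegree_paramPoly {n : ℕ} (c : ParamIdx n → ℂ) (m : Fin n) :
    (paramPoly c m).natDegree = (m : ℕ) + 1 := by
  have h : (∑ k : Fin ((m : ℕ) + 1),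
      C ((-1) ^ ((m : ℕ) + 1 - (k : ℕ)) * c ⟨m, k⟩) * X ^ (k : ℕ)).degree
      < (((m : ℕ) + 1 : ℕ) : WithBot ℕ) := by
    refine (degree_sum_le _ _).trans_lt ((Finset.sup_lt_iff (WithBot.bot_lt_coe _)).2 ?_)
    intro k _
    exact (degree_C_mul_X_pow_le _ _).trans_lt (by exact_mod_cast k.isLt)
  rw [paramPoly, natDegree_eq_of_degree_eq_some]
  rw [degree_add_eq_left_of_degree_lt (by rw [degree_X_pow]; exact h), degree_X_pow]

/-- `μ_{k,m}(c)`: the `k`-th entry of the increasing tuple `E_c(m)` of roots of `paramPoly`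
(with `m` and `k` shifted down by one). -/
def mu {n : ℕ} (c : ParamIdx n → ℂ) (m : Fin n) (k : Fin ((m : ℕ) + 1)) : ℂ :=
  (orderedRoots (paramPoly c m)).get
    (Fin.cast (by rw [length_orderedRoots, natDegree_paramPoly]) k)

/-- The eigenvalue interlacing condition: all `μ_{k,m}(c)` are real, and
`μ_{1,m+1} < μ_{1,m} < μ_{2,m+1} < ⋯ < μ_{m,m} < μ_{m+1,m+1}` for `1 ≤ m < n`. -/
def IsInterlacing {n : ℕ} (c : ParamIdx n → ℂ) : Prop :=
  (∀ (m : Fin n) (k : Fin ((m : ℕ) + 1)), (mu c m k).im = 0) ∧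
  ∀ (m : ℕ) (hm : m + 1 < n) (k : Fin (m + 1)),
    (mu c ⟨m + 1, hm⟩ k.castSucc).re < (mu c ⟨m, m.lt_succ_self.trans hm⟩ k).re ∧
    (mu c ⟨m, m.lt_succ_self.trans hm⟩ k).re < (mu c ⟨m + 1, hm⟩ k.succ).re

/-- Jacobi matrices: tridiagonal, with no zero entry on the two adjacent diagonals. -/
def IsJacobi {n : ℕ} (x : Matrix (Fin n) (Fin n) ℂ) : Prop :=
  (∀ i j : Fin n, (i : ℕ) + 1 < j ∨ (j : ℕ) + 1 < i → x i j = 0) ∧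
  ∀ i j : Fin n, (i : ℕ) + 1 = j ∨ (j : ℕ) + 1 = i → x i j ≠ 0

/-- The entries on the two adjacent diagonals are positive real numbers. -/
def HasPosAdjacentDiagonals {n : ℕ} (x : Matrix (Fin n) (Fin n) ℂ) : Prop :=
  ∀ i j : Fin n, (i : ℕ) + 1 = j ∨ (j : ℕ) + 1 = i → 0 < (x i j).re ∧ (x i j).im = 0

/-! ### Orthonormal polynomials and the compressed multiplication operator -/

/-- The measures on `ℝ` that are considered: every polynomial is integrable, and the measure is not
concentrated on a finite set (equivalently, the monomials are linearly independent in `L²`). -/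
structure IsSuitable (ν : Measure ℝ) : Prop where
  integrable (p : ℝ[X]) : Integrable (fun t => p.eval t) ν
  infinite (s : Set ℝ) : s.Finite → ν sᶜ ≠ 0

/-- `φ_0, φ_1, …` is a sequence of orthonormal polynomials for `ν`: `φ_k` is a real polynomial of
degree exactly `k`, and the sequence is orthonormal in `L²(ν)`. These are the sequences obtained
from `1, t, t², …` by the Gram–Schmidt process, up to the sign of each `φ_k`. -/
structure IsOrthonormalPolys (ν : Measure ℝ) (φ : ℕ → ℝ[X]) : Prop where
  degree_eq (k : ℕ) : (φ k).degree = k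
  integral_mul (j k : ℕ) : ∫ t, (φ j).eval t * (φ k).eval t ∂ν = if j = k then 1 else 0

/-- The Hilbert space `L²(ℝ, ν)`, with complex scalars. -/
abbrev L2 (ν : Measure ℝ) : Type := Lp ℂ 2 ν

theorem IsSuitable.memLp {ν : Measure ℝ} (hν : IsSuitable ν) (p : ℂ[X]) :
    MemLp (fun t : ℝ => p.eval (t : ℂ)) 2 ν := by
  have hm : ∀ j : ℕ, MemLp (fun t : ℝ => (t : ℂ) ^ j) 2 ν := by
    intro j
    have hc : Continuous (fun t : ℝ => (t : ℂ) ^ j) := by fun_prop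
    rw [memLp_two_iff_integrable_sq_norm hc.aestronglyMeasurable]
    refine (hν.integrable (X ^ (2 * j))).congr (Filter.Eventually.of_forall fun t => ?_)
    simp only [eval_pow, eval_X, norm_pow, Complex.norm_real, Real.norm_eq_abs]
    rw [← pow_mul, mul_comm j 2, pow_mul, pow_mul, sq_abs]
  have : (fun t : ℝ => p.eval (t : ℂ)) =
      fun t : ℝ => ∑ j ∈ Finset.range (p.natDegree + 1), p.coeff j * (t : ℂ) ^ j := by
    ext t; rw [eval_eq_sum_range]
  rw [this]
  exact memLp_finsetSum _ fun j _ => (hm j).const_mul _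

/-- The element of `L²(ℝ, ν)` defined by a polynomial function. -/
def polyL2 {ν : Measure ℝ} (hν : IsSuitable ν) : ℂ[X] →ₗ[ℂ] L2 ν where
  toFun p := (hν.memLp p).toLp _
  map_add' p q := by
    rw [← MemLp.toLp_add]; congr 1; ext t; simp
  map_smul' a p := by
    rw [RingHom.id_apply, ← MemLp.toLp_const_smul]; congr 1; ext t; simp

/-- `W_k`: the span of `1, t, …, t^{k-1}` in `L²(ℝ, ν)`. -/
def W {ν : Measure ℝ} (hν : IsSuitable ν) (k : ℕ) : Submodule ℂ (L2 ν) :=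
  Submodule.span ℂ (Set.range fun j : Fin k => polyL2 hν (X ^ (j : ℕ)))

instance {ν : Measure ℝ} (hν : IsSuitable ν) (k : ℕ) : FiniteDimensional ℂ (W hν k) :=
  FiniteDimensional.span_of_finite ℂ (Set.finite_range _)

/-- The operator of multiplication by `t` on `L²(ℝ, ν)`, with its maximal domain. -/
def mulT (ν : Measure ℝ) : L2 ν →ₗ.[ℂ] L2 ν where
  domain :=
    { carrier := {f | MemLp (fun t : ℝ => (t : ℂ) * f t) 2 ν}
      add_mem' := by
        intro f g hf hg
        refine (memLp_congr_ae ?_).2 (MemLp.add hf hg)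
        filter_upwards [Lp.coeFn_add f g] with t ht
        rw [ht, Pi.add_apply, Pi.add_apply, mul_add]
      zero_mem' := by
        refine (memLp_congr_ae ?_).2 (MemLp.zero (ε := ℂ) (p := 2) (μ := ν))
        filter_upwards [Lp.coeFn_zero ℂ 2 ν] with t ht
        rw [ht, Pi.zero_apply, mul_zero]
      smul_mem' := by
        intro a f hf
        refine (memLp_congr_ae ?_).2 (MemLp.const_smul hf a)
        filter_upwards [Lp.coeFn_smul a f] with t ht
        simp [ht, mul_left_comm] }
  toFun :=
    { toFun := fun f => MemLp.toLp (fun t : ℝ => (t : ℂ) * (f : L2 ν) t) f.2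
      map_add' := by
        intro f g
        rw [← MemLp.toLp_add]
        refine MemLp.toLp_congr _ _ ?_
        filter_upwards [Lp.coeFn_add (f : L2 ν) (g : L2 ν)] with t ht
        rw [Pi.add_apply, ← mul_add, ← Pi.add_apply, ← ht]
        rfl
      map_smul' := by
        intro a f
        rw [RingHom.id_apply, ← MemLp.toLp_const_smul]
        refine MemLp.toLp_congr _ _ ?_
        filter_upwards [Lp.coeFn_smul a (f : L2 ν)] with t ht
        simp [ht, mul_left_comm] }

theorem W_le_domain {ν : Measure ℝ} (hν : IsSuitable ν) (k : ℕ) : W hν k ≤ (mulT ν).domain := by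
  refine Submodule.span_le.2 ?_
  rintro _ ⟨j, rfl⟩
  change MemLp (fun t : ℝ => (t : ℂ) * (polyL2 hν (X ^ (j : ℕ)) : L2 ν) t) 2 ν
  refine (memLp_congr_ae ?_).2 (hν.memLp (X * X ^ (j : ℕ)))
  filter_upwards [(hν.memLp (X ^ (j : ℕ))).coeFn_toLp] with t ht
  change (t : ℂ) * ((hν.memLp (X ^ (j : ℕ))).toLp _ : L2 ν) t = _
  rw [ht, eval_mul, eval_X]

/-- The operator `Λ_k t̃` restricted to `W_k`, where `t̃` is multiplication by `t` and `Λ_k` is the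
orthogonal projection of `L²(ℝ, ν)` onto `W_k`. -/
def compress {ν : Measure ℝ} (hν : IsSuitable ν) (k : ℕ) : W hν k →ₗ[ℂ] W hν k :=
  (W hν k).orthogonalProjectionOnto.toLinearMap ∘ₗ (mulT ν).toFun ∘ₗ
    Submodule.inclusion (W_le_domain hν k)

theorem polyL2_mem_W {ν : Measure ℝ} (hν : IsSuitable ν) {k : ℕ} {p : ℂ[X]} (hp : p.degree < k) :
    polyL2 hν p ∈ W hν k := by
  rw [p.as_sum_range_C_mul_X_pow, map_sum]
  refine Submodule.sum_mem _ fun j hj => ?_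
  rw [← smul_eq_C_mul, map_smul]
  by_cases h : j < k
  · exact Submodule.smul_mem _ _ (Submodule.subset_span ⟨⟨j, h⟩, rfl⟩)
  · rw [coeff_eq_zero_of_degree_lt (hp.trans_le (by exact_mod_cast not_lt.1 h)), zero_smul]
    exact Submodule.zero_mem _

/-- A real polynomial viewed as a complex one. -/
abbrev toC (p : ℝ[X]) : ℂ[X] := p.map (algebraMap ℝ ℂ)

theorem inner_polyL2 {ν : Measure ℝ} (hν : IsSuitable ν) (p q : ℝ[X]) :
    inner ℂ (polyL2 hν (toC p)) (polyL2 hν (toC q)) =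
      ((∫ t, p.eval t * q.eval t ∂ν : ℝ) : ℂ) := by
  have e : ∀ (p : ℝ[X]) (t : ℝ), (toC p).eval (t : ℂ) = ((p.eval t : ℝ) : ℂ) := fun p t => by
    simpa using eval_map_algebraMap (B := ℂ) p (t : ℂ) |>.trans
      (aeval_algebraMap_apply_eq_algebraMap_eval t p)
  rw [L2.inner_def, ← integral_complex_ofReal]
  refine integral_congr_ae ?_
  filter_upwards [(hν.memLp (toC p)).coeFn_toLp, (hν.memLp (toC q)).coeFn_toLp] with t h1 h2
  change inner ℂ (((hν.memLp (toC p)).toLp _ : L2 ν) t) (((hν.memLp (toC q)).toLp _ : L2 ν) t) = _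
  rw [h1, h2, e, e]
  simp [mul_comm]

/-- The polynomial `φ_k`, `k < n`, as an element of `W_n`. -/
def polyVec {ν : Measure ℝ} (hν : IsSuitable ν) {φ : ℕ → ℝ[X]} (hφ : IsOrthonormalPolys ν φ)
    (n : ℕ) (k : Fin n) : W hν n :=
  ⟨polyL2 hν (toC (φ k)), polyL2_mem_W hν (by
    rw [degree_map, hφ.degree_eq]; exact_mod_cast k.isLt)⟩

theorem orthonormal_polyVec {ν : Measure ℝ} (hν : IsSuitable ν) {φ : ℕ → ℝ[X]}
    (hφ : IsOrthonormalPolys ν φ) (n : ℕ) : Orthonormal ℂ (polyVec hν hφ n) := by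
  rw [orthonormal_iff_ite]
  intro i j
  rw [Submodule.coe_inner]
  change inner ℂ (polyL2 hν (toC (φ i))) (polyL2 hν (toC (φ j))) = _
  rw [inner_polyL2, hφ.integral_mul]
  simp [Fin.ext_iff, apply_ite]

/-- The basis `φ_0, …, φ_{n-1}` of `W_n`. -/
def polyBasis {ν : Measure ℝ} (hν : IsSuitable ν) {φ : ℕ → ℝ[X]} (hφ : IsOrthonormalPolys ν φ)
    (n : ℕ) : Module.Basis (Fin n) ℂ (W hν n) :=
  Module.Basis.mk (orthonormal_polyVec hν hφ n).linearIndependent (by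
    refine ((orthonormal_polyVec hν hφ n).linearIndependent.span_eq_top_of_card_eq_finrank' ?_).ge
    refine le_antisymm
      (orthonormal_polyVec hν hφ n).linearIndependent.fintype_card_le_finrank ?_
    exact finrank_range_le_card _)

/-- The matrix of `Λ_n t̃` restricted to `W_n`, in the basis `φ_0, …, φ_{n-1}`. -/
def jacobiMatrix {ν : Measure ℝ} (hν : IsSuitable ν) {φ : ℕ → ℝ[X]} (hφ : IsOrthonormalPolys ν φ)
    (n : ℕ) : Matrix (Fin n) (Fin n) ℂ :=
  LinearMap.toMatrix (polyBasis hν hφ n) (polyBasis hν hφ n) (compress hν n)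

/-- The basis `ε_0 φ_0, …, ε_{n-1} φ_{n-1}` of `W_n`, for signs `ε_k = ±1`. -/
def signedBasis {ν : Measure ℝ} (hν : IsSuitable ν) {φ : ℕ → ℝ[X]} (hφ : IsOrthonormalPolys ν φ)
    (n : ℕ) (ε : Fin n → ℤˣ) : Module.Basis (Fin n) ℂ (W hν n) :=
  (polyBasis hν hφ n).unitsSMul fun k => Units.map (Int.castRingHom ℂ).toMonoidHom (ε k)

/-- The matrix of `Λ_n t̃` restricted to `W_n`, in the basis `ε_0 φ_0, …, ε_{n-1} φ_{n-1}`. -/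
def signedMatrix {ν : Measure ℝ} (hν : IsSuitable ν) {φ : ℕ → ℝ[X]} (hφ : IsOrthonormalPolys ν φ)
    (n : ℕ) (ε : Fin n → ℤˣ) : Matrix (Fin n) (Fin n) ℂ :=
  LinearMap.toMatrix (signedBasis hν hφ n ε) (signedBasis hν hφ n ε) (compress hν n)

end OrthoJacobi

end

/-!
Let `p m` be the monic multiple of `φ m`. The entries of `x` are `∫ t φ_i φ_j dν`, which vanish for
`|i - j| > 1` by orthogonality, so expanding `t φ_k` in orthonormal polynomials gives the three-term
recurrence `p (m + 2) = (t - a) * p (m + 1) - b² * p m` with `a`, `b` the entries of `x`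
(`threeTermRecurrence_monicPoly`). Expanding the determinant of a cutoff of a symmetric Jacobi matrix
along its last row and column gives the same recurrence (`charpoly_cutoff_add_two`), so `p m` is the
characteristic polynomial of the cutoff `x_m`.

*Interlacing.* At a root of `p (m + 1)` the values of `p (m + 2)` and `p m` have opposite signs, since
`b² > 0`. By the intermediate value theorem the strict interlacing of the roots of `p m` and
`p (m + 1)` passes to `p (m + 1)` and `p (m + 2)` (`ThreeTermRecurrence.exists_roots`).

*Counting symmetric matrices.* Interlacing is used only through its algebraic consequences: each `p m`
has distinct roots, and `p m`, `p (m + 1)` have no common root. A symmetric `A` with characteristic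
polynomial `p m` is then diagonalized by a complex orthogonal matrix, although it need not be real
(`exists_orthogonal_diagonalization`). Border `A` by a column with coordinates `z_i` in the eigenbasis
and a corner entry. The characteristic polynomial of the result takes the value
`-z_i² ∏_{j ≠ i} (μ_i - μ_j)` at the eigenvalue `μ_i` of `A`. Prescribing it to be `p (m + 1)` fixes
the corner entry and each `z_i²`, which is nonzero, leaving `2 ^ m` choices
(`ncard_symm_extensions`). The total is `2 ^ (0 + 1 + ⋯ + (n - 1))`.

*Jacobi matrices.* For a symmetric Jacobi matrix the recurrence determines the diagonal entries and
the squares of the off-diagonal entries from the characteristic polynomials, so the Jacobi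
matrices in the fibre are the conjugates of `x` by diagonal sign matrices (`exists_signConj_eq`),
which are the matrices in the bases `ε_k φ_k`. The signs with `ε_0 = 1` are recovered from the
nonzero off-diagonal entries, and positivity of these entries leaves only `x`. Finally, a matrix
whose cutoffs have the zeros of `φ m` as their sets of eigenvalues lies in the fibre, since these
`m` zeros are distinct.
-/

noncomputable section

namespace OrthoJacobi

open Matrix

/-! ### Determinants of bordered matrices -/

/-- The determinant of a bordered matrix, with no invertibility assumption: the block elimination
needs `det A` to be cancellable, which holds for `X + A` over the polynomial ring, and evaluation at
`0` gives the identity for `A`. -/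
theorem det_fromBlocks_border {R ι : Type*} [CommRing R] [Fintype ι] [DecidableEq ι]
    (A : Matrix ι ι R) (u w : ι → R) (s : R) :
    (fromBlocks A (replicateCol Unit u) (replicateRow Unit w) (of fun _ _ => s)).det =
      s * A.det - w ⬝ᵥ (A.adjugate *ᵥ u) := by
  have key : ∀ {S : Type _} [CommRing S] (A : Matrix ι ι S) (u w : ι → S) (s : S),
      IsRegular A.det →
      (fromBlocks A (replicateCol Unit u) (replicateRow Unit w) (of fun _ _ => s)).det =
        s * A.det - w ⬝ᵥ (A.adjugate *ᵥ u) := by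
    intro S _ A u w s hA
    have hmul : fromBlocks A (replicateCol Unit u) (replicateRow Unit w) (of fun _ _ => s) *
        fromBlocks 1 (replicateCol Unit (-(A.adjugate *ᵥ u))) 0 (of fun _ _ => A.det) =
        fromBlocks A 0 (replicateRow Unit w)
          (of fun _ _ => s * A.det - w ⬝ᵥ (A.adjugate *ᵥ u)) := by
      rw [fromBlocks_multiply]
      congr 1
      · simp
      · ext i j
        have : (A *ᵥ (A.adjugate *ᵥ u)) i = A.det * u i := by
          rw [mulVec_mulVec, mul_adjugate, smul_mulVec, one_mulVec]; rfl
        simp only [Matrix.add_apply, Matrix.mul_apply, replicateCol_apply, Pi.neg_apply, mul_neg,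
          Finset.sum_neg_distrib, of_apply, Finset.univ_unique, Finset.sum_singleton,
          Matrix.zero_apply]
        rw [← mul_comm, ← this]
        simp [mulVec, dotProduct]
      · simp
      · ext i j
        simp [Matrix.mul_apply, dotProduct]
        ring
    have := congrArg det hmul
    rw [det_mul, det_fromBlocks_zero₂₁, det_fromBlocks_zero₁₂] at this
    simp only [det_one, one_mul, det_unique, of_apply] at this
    exact hA.right (by simpa [mul_comm] using this)
  have h := key (A := charmatrix (-A)) (u := fun i => C (u i)) (w := fun i => C (w i)) (s := C s)
    (by exact (charpoly_monic (-A)).isRegular)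
  have hA : (evalRingHom (0 : R)).mapMatrix (charmatrix (-A)) = A := by
    ext i j
    by_cases hij : i = j
    · subst hij; simp
    · simp [hij]
  have h0 := congrArg (evalRingHom (0 : R)) h
  rw [RingHom.map_det, map_sub, map_mul, RingHom.map_det, hA] at h0
  convert h0 using 2
  · ext i j
    rcases i with i | i <;> rcases j with j | j
    · simpa using congrFun (congrFun hA.symm i) j
    all_goals simp
  · simp
  · have hadj := RingHom.map_adjugate (evalRingHom (0 : R)) (charmatrix (-A))
    rw [hA] at hadj
    rw [← hadj]
    simp [dotProduct, mulVec, eval_finsetSum]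

/-- Expansion of a determinant along its last row and column. -/
theorem det_eq_last_sub {R : Type*} [CommRing R] {m : ℕ} (Y : Matrix (Fin (m + 1)) (Fin (m + 1)) R) :
    Y.det = Y (Fin.last m) (Fin.last m) * (Y.submatrix Fin.castSucc Fin.castSucc).det -
      (fun i : Fin m => Y (Fin.last m) i.castSucc) ⬝ᵥ
        ((Y.submatrix Fin.castSucc Fin.castSucc).adjugate *ᵥ
          fun i : Fin m => Y i.castSucc (Fin.last m)) := by
  rw [← det_fromBlocks_border]
  let e : Fin m ⊕ Unit ≃ Fin (m + 1) :=
    (Equiv.sumCongr (Equiv.refl _) (Equiv.ofUnique Unit (Fin 1))).trans finSumFinEquiv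
  rw [← det_submatrix_equiv_self e Y]
  congr 1
  ext i j
  rcases i with i | i <;> rcases j with j | j <;> simp [e] <;> rfl

/-- The evaluated characteristic polynomial, expanded along the last row and column. -/
theorem eval_charpoly_succ {m : ℕ} (Y : Matrix (Fin (m + 1)) (Fin (m + 1)) ℂ) (z : ℂ) :
    Y.charpoly.eval z =
      (z - Y (Fin.last m) (Fin.last m)) * (Y.submatrix Fin.castSucc Fin.castSucc).charpoly.eval z -
      (fun i : Fin m => Y (Fin.last m) i.castSucc) ⬝ᵥ
        ((scalar (Fin m) z - Y.submatrix Fin.castSucc Fin.castSucc).adjugate *ᵥ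
          fun i : Fin m => Y i.castSucc (Fin.last m)) := by
  rw [eval_charpoly, eval_charpoly, det_eq_last_sub]
  have hsub : (scalar (Fin (m + 1)) z - Y).submatrix Fin.castSucc Fin.castSucc =
      scalar (Fin m) z - Y.submatrix Fin.castSucc Fin.castSucc := by
    ext i j
    simp [diagonal_apply]
  have h1 : (fun i : Fin m => (scalar (Fin (m + 1)) z - Y) (Fin.last m) i.castSucc) =
      -fun i : Fin m => Y (Fin.last m) i.castSucc := by
    ext i; simp [(Fin.castSucc_lt_last i).ne']
  have h2 : (fun i : Fin m => (scalar (Fin (m + 1)) z - Y) i.castSucc (Fin.last m)) =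
      -fun i : Fin m => Y i.castSucc (Fin.last m) := by
    ext i; simp [(Fin.castSucc_lt_last i).ne]
  rw [hsub, h1, h2, mulVec_neg, neg_dotProduct_neg]
  simp

/-! ### Diagonalization of complex symmetric matrices -/

/-- A complex symmetric matrix with distinct eigenvalues is diagonalized by a complex orthogonal
matrix: eigenvectors for distinct eigenvalues are orthogonal for the bilinear dot product, so none
of them can be isotropic. -/
theorem exists_orthogonal_diagonalization {ι : Type*} [Fintype ι] [DecidableEq ι]
    {A : Matrix ι ι ℂ} (hA : A.IsSymm) {μ : ι → ℂ} (hμ : Function.Injective μ)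
    (hroot : ∀ i, A.charpoly.IsRoot (μ i)) :
    ∃ P : Matrix ι ι ℂ, Pᵀ * P = 1 ∧ A = P * diagonal μ * Pᵀ := by
  have hev : ∀ i, ∃ v : ι → ℂ, v ≠ 0 ∧ A *ᵥ v = μ i • v := by
    intro i
    have h := hroot i
    rw [IsRoot, eval_charpoly, ← exists_mulVec_eq_zero_iff] at h
    obtain ⟨v, hv, h⟩ := h
    refine ⟨v, hv, ?_⟩
    rw [sub_mulVec, sub_eq_zero] at h
    rw [← h]
    ext j
    simp [mulVec_diagonal]
  choose v hv0 hv using hev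
  have hli : LinearIndependent ℂ v := by
    refine Module.End.eigenvectors_linearIndependent' (Matrix.toLin' A) μ hμ v fun i => ?_
    rw [Module.End.hasEigenvector_iff, Module.End.mem_eigenspace_iff]
    exact ⟨by simpa using hv i, hv0 i⟩
  have horth : ∀ i j, i ≠ j → v i ⬝ᵥ v j = 0 := by
    intro i j hij
    have h1 : v i ⬝ᵥ (A *ᵥ v j) = (A *ᵥ v i) ⬝ᵥ v j := by
      rw [dotProduct_mulVec, ← mulVec_transpose, hA.eq]
    rw [hv, hv, dotProduct_smul, smul_dotProduct, smul_eq_mul, smul_eq_mul] at h1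
    have : (μ j - μ i) * (v i ⬝ᵥ v j) = 0 := by linear_combination h1
    exact (mul_eq_zero.1 this).resolve_left (sub_ne_zero.2 fun h => hij (hμ h).symm)
  -- a vector orthogonal to itself would be orthogonal to the whole eigenbasis
  have hself : ∀ i, v i ⬝ᵥ v i ≠ 0 := by
    intro i h
    refine hv0 i (dotProduct_eq_zero _ fun w => ?_)
    have hspan : Submodule.span ℂ (Set.range v) = ⊤ :=
      hli.span_eq_top_of_card_eq_finrank' (by simp)
    have hw : w ∈ Submodule.span ℂ (Set.range v) := hspan ▸ Submodule.mem_top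
    induction hw using Submodule.span_induction with
    | mem x hx =>
      obtain ⟨j, rfl⟩ := hx
      by_cases hij : i = j
      · rw [← hij, h]
      · exact horth i j hij
    | zero => simp
    | add x y _ _ hx hy => rw [dotProduct_add, hx, hy, add_zero]
    | smul a x _ hx => rw [dotProduct_smul, hx, smul_zero]
  choose s hs using fun i => IsAlgClosed.exists_pow_nat_eq (v i ⬝ᵥ v i) two_pos
  have hs0 : ∀ i, s i ≠ 0 := fun i h => hself i (by rw [← hs i, h]; simp)
  let P : Matrix ι ι ℂ := of fun a i => (s i)⁻¹ * v i a
  have hP : Pᵀ * P = 1 := by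
    ext i j
    have : (Pᵀ * P) i j = (s i)⁻¹ * (s j)⁻¹ * (v i ⬝ᵥ v j) := by
      simp only [Matrix.mul_apply, dotProduct, Finset.mul_sum, P, transpose_apply, of_apply]
      exact Finset.sum_congr rfl fun a _ => by ring
    rw [this]
    by_cases hij : i = j
    · subst hij
      rw [← hs i, one_apply_eq]
      field_simp [hs0 i]
    · rw [horth i j hij, one_apply_ne hij, mul_zero]
  have hAP : A * P = P * diagonal μ := by
    ext a i
    have h := congrFun (hv i) a
    rw [mul_diagonal]
    simp only [Matrix.mul_apply, P, of_apply]
    simp only [mulVec, dotProduct, Pi.smul_apply, smul_eq_mul] at h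
    calc ∑ j, A a j * ((s i)⁻¹ * v i j) = (s i)⁻¹ * ∑ j, A a j * v i j := by
          rw [Finset.mul_sum]; exact Finset.sum_congr rfl fun _ _ => by ring
      _ = _ := by rw [h]; ring
  refine ⟨P, hP, ?_⟩
  rw [← hAP, Matrix.mul_assoc, mul_eq_one_comm.1 hP, Matrix.mul_one]

/-- Conjugation by an orthogonal matrix commutes with the adjugate; the determinants of the two
orthogonal factors are equal to the same sign and cancel. -/
theorem adjugate_scalar_sub_conj {ι : Type*} [Fintype ι] [DecidableEq ι]
    {P : Matrix ι ι ℂ} (hP : Pᵀ * P = 1) (D : Matrix ι ι ℂ) (z : ℂ) :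
    (scalar ι z - P * D * Pᵀ).adjugate = P * (scalar ι z - D).adjugate * Pᵀ := by
  have hP' : P * Pᵀ = 1 := mul_eq_one_comm.1 hP
  have h : scalar ι z - P * D * Pᵀ = P * (scalar ι z - D) * Pᵀ := by
    rw [Matrix.mul_sub, Matrix.sub_mul, ← (scalar_commute z (fun r => mul_comm z r) P).eq,
      Matrix.mul_assoc (scalar ι z), hP', Matrix.mul_one]
  have hdet : P.det * P.det = 1 := by
    simpa using congrArg det hP
  have a1 : P.adjugate = P.det • Pᵀ := by
    calc P.adjugate = Pᵀ * P * P.adjugate := by rw [hP, Matrix.one_mul]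
      _ = _ := by rw [Matrix.mul_assoc, mul_adjugate, Matrix.mul_smul, Matrix.mul_one]
  have a2 : Pᵀ.adjugate = P.det • P := by
    rw [← adjugate_transpose, a1, transpose_smul, transpose_transpose]
  rw [h, adjugate_mul_distrib, adjugate_mul_distrib, a1, a2]
  simp only [Matrix.smul_mul, Matrix.mul_smul, smul_smul, hdet, one_smul, Matrix.mul_assoc]

/-! ### Symmetric matrices with prescribed characteristic polynomials of cutoffs -/

/-- The symmetric matrix of size `m + 1` with cutoff `A`, last column `b` above the diagonal, and
last diagonal entry `a`. -/
def border {m : ℕ} (A : Matrix (Fin m) (Fin m) ℂ) (b : Fin m → ℂ) (a : ℂ) :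
    Matrix (Fin (m + 1)) (Fin (m + 1)) ℂ :=
  of (Fin.snoc (fun i => Fin.snoc (A i) (b i)) (Fin.snoc b a))

section border

variable {m : ℕ} (A : Matrix (Fin m) (Fin m) ℂ) (b : Fin m → ℂ) (a : ℂ)

@[simp] theorem border_castSucc_castSucc (i j : Fin m) :
    border A b a i.castSucc j.castSucc = A i j := by
  simp [border]

@[simp] theorem border_castSucc_last (i : Fin m) :
    border A b a i.castSucc (Fin.last m) = b i := by
  simp [border]

@[simp] theorem border_last_castSucc (i : Fin m) :
    border A b a (Fin.last m) i.castSucc = b i := by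
  simp [border]

@[simp] theorem border_last_last : border A b a (Fin.last m) (Fin.last m) = a := by
  simp [border]

@[simp] theorem submatrix_border : (border A b a).submatrix Fin.castSucc Fin.castSucc = A := by
  ext i j; simp

variable {A} in
theorem isSymm_border (hA : A.IsSymm) : (border A b a).IsSymm := by
  refine IsSymm.ext fun i j => ?_
  induction i using Fin.lastCases <;> induction j using Fin.lastCases <;> simp [hA.apply]

theorem eq_border_of_isSymm {Y : Matrix (Fin (m + 1)) (Fin (m + 1)) ℂ} (hY : Y.IsSymm) :
    Y = border (Y.submatrix Fin.castSucc Fin.castSucc)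
      (fun i => Y i.castSucc (Fin.last m)) (Y (Fin.last m) (Fin.last m)) := by
  ext i j
  induction i using Fin.lastCases <;> induction j using Fin.lastCases <;> simp [hY.apply]

theorem trace_border : (border A b a).trace = A.trace + a := by
  simp [trace, Fin.sum_univ_castSucc]

end border

/-- A monic polynomial of degree `m + 1` is determined by its trace coefficient and its values at
`m` distinct points. -/
theorem eq_of_monic_of_coeff_of_eval {m : ℕ} {p q : ℂ[X]} (hp : p.Monic) (hq : q.Monic)
    (hpd : p.natDegree = m + 1) (hqd : q.natDegree = m + 1) (hc : p.coeff m = q.coeff m)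
    {μ : Fin m → ℂ} (hμ : Function.Injective μ) (h : ∀ i, p.eval (μ i) = q.eval (μ i)) : p = q := by
  rw [← sub_eq_zero]
  refine eq_zero_of_degree_lt_of_eval_finset_eq_zero (Finset.univ.map ⟨μ, hμ⟩) ?_ ?_
  · rw [Finset.card_map, Finset.card_univ, Fintype.card_fin, degree_lt_iff_coeff_zero]
    intro k hk
    rw [coeff_sub, sub_eq_zero]
    rcases hk.eq_or_lt with rfl | hk
    · exact hc
    rcases (Nat.succ_le_of_lt hk).eq_or_lt with rfl | hk
    · rw [← Nat.succ_eq_add_one] at hpd hqd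
      rw [← hpd, hp.coeff_natDegree, hpd, ← hqd, hq.coeff_natDegree]
    · rw [coeff_eq_zero_of_natDegree_lt (by omega), coeff_eq_zero_of_natDegree_lt (by omega)]
  · simp [h]

/-- At an eigenvalue of a diagonal matrix only one term of the adjugate quadratic form survives. -/
theorem dotProduct_adjugate_scalar_sub_diagonal {m : ℕ} (μ : Fin m → ℂ) (i : Fin m) (z : Fin m → ℂ) :
    z ⬝ᵥ ((scalar (Fin m) (μ i) - diagonal μ).adjugate *ᵥ z) =
      z i ^ 2 * ∏ j ∈ Finset.univ.erase i, (μ i - μ j) := by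
  have h : scalar (Fin m) (μ i) - diagonal μ = diagonal fun j => μ i - μ j := by
    ext a b
    by_cases hab : a = b <;> simp [hab]
  rw [h, adjugate_diagonal]
  simp only [mulVec_diagonal, dotProduct]
  rw [Finset.sum_eq_single i]
  · ring
  · intro j _ hj
    rw [Finset.prod_eq_zero (Finset.mem_erase.2 ⟨hj.symm, Finset.mem_univ i⟩) (sub_self _)]
    ring
  · simp

theorem ncard_sq_eq {r : ℂ} (hr : r ≠ 0) : {z : ℂ | z ^ 2 = r}.ncard = 2 := by
  obtain ⟨s, rfl⟩ := IsAlgClosed.exists_pow_nat_eq r two_pos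
  have hs : s ≠ 0 := by rintro rfl; simp at hr
  have : {z : ℂ | z ^ 2 = s ^ 2} = {s, -s} := by
    ext z; simp [sq_eq_sq_iff_eq_or_eq_neg]
  rw [this, Set.ncard_pair]
  exact fun h => hs (self_eq_neg.1 h)

theorem ncard_forall_sq_eq {m : ℕ} {r : Fin m → ℂ} (hr : ∀ i, r i ≠ 0) :
    {z : Fin m → ℂ | ∀ i, z i ^ 2 = r i}.ncard = 2 ^ m := by
  let e : {z : Fin m → ℂ | ∀ i, z i ^ 2 = r i} ≃ ∀ i, {w : ℂ | w ^ 2 = r i} :=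
    { toFun := fun z i => ⟨z.1 i, z.2 i⟩
      invFun := fun z => ⟨fun i => (z i).1, fun i => (z i).2⟩
      left_inv := fun _ => rfl
      right_inv := fun _ => rfl }
  rw [← Nat.card_coe_set_eq, Nat.card_congr e, Nat.card_pi]
  simp [Nat.card_coe_set_eq, ncard_sq_eq (hr _)]

/-- Let `A` be symmetric with `m` distinct eigenvalues, and `q` monic of degree `m + 1`, nonzero at
these eigenvalues. Then `A` has exactly `2 ^ m` symmetric extensions by one row and column with
characteristic polynomial `q`: the last diagonal entry is given by the trace, and in coordinates
diagonalizing `A` the last column has prescribed nonzero squares. -/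
theorem ncard_symm_extensions {m : ℕ} {A : Matrix (Fin m) (Fin m) ℂ} (hA : A.IsSymm)
    {μ : Fin m → ℂ} (hμ : Function.Injective μ) (hroot : ∀ i, A.charpoly.IsRoot (μ i))
    {q : ℂ[X]} (hq : q.Monic) (hqd : q.natDegree = m + 1) (hq0 : ∀ i, q.eval (μ i) ≠ 0) :
    {Y : Matrix (Fin (m + 1)) (Fin (m + 1)) ℂ | Y.IsSymm ∧
      Y.submatrix Fin.castSucc Fin.castSucc = A ∧ Y.charpoly = q}.ncard = 2 ^ m := by
  obtain ⟨P, hP, hAP⟩ := exists_orthogonal_diagonalization hA hμ hroot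
  have hP' : P * Pᵀ = 1 := mul_eq_one_comm.1 hP
  have hd : ∀ i, ∏ j ∈ Finset.univ.erase i, (μ i - μ j) ≠ 0 := fun i =>
    Finset.prod_ne_zero_iff.2 fun j hj => sub_ne_zero.2 fun h => (Finset.mem_erase.1 hj).1 (hμ h).symm
  -- the squares of the coordinates of the last column, and the last diagonal entry
  let r : Fin m → ℂ := fun i => -q.eval (μ i) / ∏ j ∈ Finset.univ.erase i, (μ i - μ j)
  let a : ℂ := -q.coeff m - A.trace
  have heval : ∀ (z : Fin m → ℂ) (a : ℂ) (i : Fin m),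
      (border A (P *ᵥ z) a).charpoly.eval (μ i) =
        -(z i ^ 2 * ∏ j ∈ Finset.univ.erase i, (μ i - μ j)) := by
    intro z a i
    rw [eval_charpoly_succ]
    simp only [submatrix_border, border_last_castSucc, border_castSucc_last, border_last_last]
    rw [(hroot i).eq_zero, mul_zero, zero_sub, ← dotProduct_adjugate_scalar_sub_diagonal]
    congr 1
    change (P *ᵥ z) ⬝ᵥ ((scalar (Fin m) (μ i) - A).adjugate *ᵥ (P *ᵥ z)) = _
    rw [hAP, adjugate_scalar_sub_conj hP, mulVec_mulVec, Matrix.mul_assoc, hP, Matrix.mul_one,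
      ← mulVec_mulVec, dotProduct_mulVec, ← mulVec_transpose, mulVec_mulVec, hP, one_mulVec]
  have hset : {Y : Matrix (Fin (m + 1)) (Fin (m + 1)) ℂ | Y.IsSymm ∧
      Y.submatrix Fin.castSucc Fin.castSucc = A ∧ Y.charpoly = q} =
      (fun z => border A (P *ᵥ z) a) '' {z : Fin m → ℂ | ∀ i, z i ^ 2 = r i} := by
    ext Y
    constructor
    · rintro ⟨hY, hYA, hYq⟩
      have hYb := eq_border_of_isSymm hY
      rw [hYA] at hYb
      obtain ⟨z, hz⟩ : ∃ z, P *ᵥ z = fun i => Y i.castSucc (Fin.last m) :=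
        ⟨Pᵀ *ᵥ _, by rw [mulVec_mulVec, hP', one_mulVec]⟩
      rw [← hz] at hYb
      refine ⟨z, fun i => ?_, ?_⟩
      · have := heval z (Y (Fin.last m) (Fin.last m)) i
        rw [← hYb, hYq] at this
        rw [eq_div_iff (hd i), this, neg_neg]
      · have ht := trace_eq_neg_charpoly_coeff Y
        rw [hYq, hYb, trace_border, Fintype.card_fin, Nat.add_sub_cancel] at ht
        have : a = Y (Fin.last m) (Fin.last m) := by
          linear_combination -ht
        simp only [this]
        exact hYb.symm
    · rintro ⟨z, hz, rfl⟩
      refine ⟨isSymm_border _ _ hA, submatrix_border _ _ _, ?_⟩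
      refine eq_of_monic_of_coeff_of_eval (charpoly_monic _) hq (by simp) hqd ?_ hμ fun i => ?_
      · have ht := trace_eq_neg_charpoly_coeff (border A (P *ᵥ z) a)
        rw [trace_border, Fintype.card_fin, Nat.add_sub_cancel] at ht
        linear_combination ht
      · rw [heval, hz i, div_mul_cancel₀ _ (hd i), neg_neg]
  rw [hset, Set.ncard_image_of_injective, ncard_forall_sq_eq]
  · exact fun i => div_ne_zero (neg_ne_zero.2 (hq0 i)) (hd i)
  · intro z w h
    have hzw : P *ᵥ z = P *ᵥ w := by
      ext i
      simpa using congrFun (congrFun h i.castSucc) (Fin.last m)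
    simpa [hP] using congrArg (Pᵀ *ᵥ ·) hzw

/-- The symmetric matrices of size `n` whose cutoffs have the characteristic polynomials `p m`. -/
def symmWithCharpolys (p : ℕ → ℂ[X]) (n : ℕ) : Set (Matrix (Fin n) (Fin n) ℂ) :=
  {y | y.IsSymm ∧ ∀ (m : ℕ) (hm : m ≤ n), (cutoff y m hm).charpoly = p m}

theorem mem_symmWithCharpolys_succ {p : ℕ → ℂ[X]} {n : ℕ}
    {y : Matrix (Fin (n + 1)) (Fin (n + 1)) ℂ} :
    y ∈ symmWithCharpolys p (n + 1) ↔ y.submatrix Fin.castSucc Fin.castSucc ∈ symmWithCharpolys p n ∧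
      y.IsSymm ∧ y.charpoly = p (n + 1) := by
  constructor
  · rintro ⟨hs, hy⟩
    exact ⟨⟨hs.submatrix _, fun m hm => hy m (hm.trans n.le_succ)⟩, hs, hy (n + 1) le_rfl⟩
  · rintro ⟨⟨_, hy⟩, hs, hn⟩
    refine ⟨hs, fun m hm => ?_⟩
    rcases hm.eq_or_lt with rfl | hm'
    · exact hn
    · exact hy m (Nat.lt_succ_iff.1 hm')

/-- If `p m` is monic of degree `m` with `m` distinct roots and shares no root with `p (m + 1)`,
there are `2 ^ (n (n - 1) / 2)` symmetric matrices with these characteristic polynomials. -/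
theorem ncard_symmWithCharpolys {p : ℕ → ℂ[X]} (hmonic : ∀ m, (p m).Monic)
    (hdeg : ∀ m, (p m).natDegree = m) (ρ : ∀ m, Fin m → ℂ) (hρ : ∀ m, Function.Injective (ρ m))
    (hroot : ∀ m i, (p m).IsRoot (ρ m i)) (hne : ∀ m i, (p (m + 1)).eval (ρ m i) ≠ 0) (n : ℕ) :
    (symmWithCharpolys p n).ncard = 2 ^ (n * (n - 1) / 2) := by
  induction n with
  | zero =>
    rw [Set.ncard_eq_one.2]
    · simp
    refine ⟨0, Set.eq_singleton_iff_unique_mem.2 ⟨⟨Subsingleton.elim _ _, fun m hm => ?_⟩,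
      fun _ _ => Subsingleton.elim _ _⟩⟩
    obtain rfl := Nat.le_zero.1 hm
    rw [(hmonic 0).natDegree_eq_zero.1 (hdeg 0)]
    simp [charpoly]
  | succ n ih =>
    have hfin : (symmWithCharpolys p n).Finite :=
      Set.finite_of_ncard_ne_zero (by rw [ih]; positivity)
    have := hfin.fintype
    let f : symmWithCharpolys p (n + 1) → symmWithCharpolys p n := fun y =>
      ⟨_, (mem_symmWithCharpolys_succ.1 y.2).1⟩
    have hcard : ∀ A : symmWithCharpolys p n, Nat.card {y // f y = A} = 2 ^ n := by
      intro A
      have hA : A.1.charpoly = p n := A.2.2 n le_rfl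
      rw [← ncard_symm_extensions A.2.1 (hρ n) (fun i => hA ▸ hroot n i) (hmonic (n + 1))
        (hdeg (n + 1)) (hne n), ← Nat.card_coe_set_eq]
      exact Nat.card_congr
        { toFun := fun y => ⟨y.1.1, y.1.2.1, congrArg Subtype.val y.2, y.1.2.2 (n + 1) le_rfl⟩
          invFun := fun y => ⟨⟨y.1, mem_symmWithCharpolys_succ.2
            ⟨y.2.2.1.symm ▸ A.2, y.2.1, y.2.2.2⟩⟩, Subtype.ext y.2.2.1⟩
          left_inv := fun _ => rfl
          right_inv := fun _ => rfl }
    have : ∀ A, Finite {y // f y = A} := fun A =>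
      Nat.finite_of_card_ne_zero (by rw [hcard]; positivity)
    rw [← Nat.card_coe_set_eq, ← Nat.card_congr (Equiv.sigmaFiberEquiv f), Nat.card_sigma]
    simp only [hcard, Finset.sum_const, smul_eq_mul, Finset.card_univ]
    rw [← Nat.card_eq_fintype_card, Nat.card_coe_set_eq, ih, ← pow_add]
    congr 1
    rw [← Nat.choose_two_right, ← Nat.choose_two_right, Nat.choose_succ_succ' n 1,
      Nat.choose_one_right, add_comm]

/-! ### Interlacing roots of polynomials in a three-term recurrence -/

/-- A monic polynomial of degree `N` is the product over any `N` distinct roots. -/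
theorem eq_prod_X_sub_C_of_monic {K : Type*} [Field K] {P : K[X]} (hP : P.Monic) {N : ℕ}
    (hN : P.natDegree = N) {r : ℕ → K} (hr : Set.InjOn r (Finset.range N))
    (hroot : ∀ i < N, P.eval (r i) = 0) : P = ∏ i ∈ Finset.range N, (X - C (r i)) := by
  refine eq_of_monic_of_dvd_of_natDegree_le (monic_prod_of_monic _ _ fun i _ => monic_X_sub_C _) hP
    ?_ ?_
  · refine Finset.prod_dvd_of_coprime (fun i hi j hj hij => ?_) fun i hi =>
      dvd_iff_isRoot.2 (hroot i (Finset.mem_range.1 hi))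
    exact isCoprime_X_sub_C_of_isUnit_sub (sub_ne_zero.2 fun h => hij (hr hi hj h)).isUnit
  · rw [natDegree_prod_of_monic _ _ fun i _ => monic_X_sub_C _]
    simp [hN]

/-- The values of a monic real polynomial of degree `N` have sign `(-1) ^ N` near `-∞`. -/
theorem exists_lt_sign_eval {P : ℝ[X]} (hP : P.Monic) {N : ℕ} (hN : P.natDegree = N) (hpos : 0 < N)
    (B : ℝ) : ∃ L < B, 0 < (-1) ^ N * P.eval L := by
  let Q : ℝ[X] := C ((-1) ^ N) * P.comp (-X)
  have hlead : Q.leadingCoeff = 1 := by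
    rw [leadingCoeff_mul, leadingCoeff_C, leadingCoeff_comp (by simp), hP.leadingCoeff, hN]
    simp [← mul_pow]
  have hdeg : 0 < Q.degree := by
    rw [← natDegree_pos_iff_degree_pos, natDegree_C_mul (pow_ne_zero _ (by simp)), natDegree_comp]
    simp [hN, hpos]
  have h := Q.tendsto_atTop_of_leadingCoeff_nonneg hdeg (by rw [hlead]; exact zero_le_one)
  obtain ⟨x, hx, hxB⟩ := ((h.eventually_gt_atTop 0).and (Filter.eventually_gt_atTop (-B))).exists
  exact ⟨-x, by linarith, by simpa [Q] using hx⟩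

theorem exists_gt_eval_pos {P : ℝ[X]} (hP : P.Monic) (hpos : 0 < P.natDegree)
    (B : ℝ) : ∃ H > B, 0 < P.eval H := by
  have h := P.tendsto_atTop_of_leadingCoeff_nonneg (natDegree_pos_iff_degree_pos.1 hpos)
    (by rw [hP.leadingCoeff]; exact zero_le_one)
  obtain ⟨x, hx, hxB⟩ := ((h.eventually_gt_atTop 0).and (Filter.eventually_gt_atTop B)).exists
  exact ⟨x, hxB, hx⟩

/-- A monic real polynomial of degree `N + 1` with alternating signs at `N` points, ending with a
negative value, has a root in each of the `N + 1` intervals cut out by these points. -/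
theorem exists_roots_of_alternating {P : ℝ[X]} (hP : P.Monic) {N : ℕ} (hN : P.natDegree = N + 1)
    {r : ℕ → ℝ} (hr : ∀ i j, i < j → j < N → r i < r j)
    (hsign : ∀ i < N, 0 < (-1) ^ (N - i) * P.eval (r i)) :
    ∃ q : ℕ → ℝ, P = ∏ i ∈ Finset.range (N + 1), (X - C (q i)) ∧
      ∀ i < N, q i < r i ∧ r i < q (i + 1) := by
  obtain ⟨L, hL, hLs⟩ := exists_lt_sign_eval hP hN N.succ_pos (r 0)
  obtain ⟨H, hH, hHs⟩ := exists_gt_eval_pos hP (by omega) (max L (r (N - 1)))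
  -- the points `L < r 0 < ⋯ < r (N - 1) < H`
  let R : ℕ → ℝ := fun j => if j = 0 then L else if j = N + 1 then H else r (j - 1)
  have hRs : ∀ j ≤ N + 1, 0 < (-1) ^ (N + 1 - j) * P.eval (R j) := by
    intro j hj
    by_cases h0 : j = 0
    · simpa [R, h0] using hLs
    by_cases h1 : j = N + 1
    · simpa [R, h1] using hHs
    · have := hsign (j - 1) (by omega)
      rw [show N - (j - 1) = N + 1 - j by omega] at this
      simpa [R, h0, h1] using this
  have hRlt : ∀ j ≤ N, R j < R (j + 1) := by
    intro j hj
    by_cases h1 : j = N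
    · by_cases h0 : j = 0
      · simp only [R, h0, if_true]
        rw [if_neg (by omega), if_pos (by omega)]
        exact (le_max_left _ _).trans_lt hH
      · simp only [R]
        rw [if_neg h0, if_neg (by omega), if_neg (by omega), if_pos (by omega), h1]
        exact (le_max_right _ _).trans_lt hH
    · by_cases h0 : j = 0
      · simp only [R, h0, if_true]
        rw [if_neg (by omega), if_neg (by omega)]
        exact hL
      · simp only [R]
        rw [if_neg h0, if_neg (by omega), if_neg (by omega), if_neg (by omega)]
        exact hr _ _ (by omega) (by omega)
  have hex : ∀ j, ∃ x, j ≤ N → (R j < x ∧ x < R (j + 1)) ∧ P.eval x = 0 := by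
    intro j
    by_cases hj : j ≤ N
    · let g : ℝ → ℝ := fun x => (-1) ^ (N - j) * P.eval x
      have hg : ContinuousOn g (Set.Icc (R j) (R (j + 1))) := by
        have := P.continuous
        fun_prop
      have h1 : g (R j) < 0 := by
        have := hRs j (by omega)
        rw [show N + 1 - j = (N - j) + 1 by omega, pow_succ] at this
        simp only [g]; linarith
      have h2 : 0 < g (R (j + 1)) := by
        have := hRs (j + 1) (by omega)
        rwa [show N + 1 - (j + 1) = N - j by omega] at this
      obtain ⟨x, hx, hgx⟩ := intermediate_value_Ioo (hRlt j hj).le hg ⟨h1, h2⟩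
      exact ⟨x, fun _ => ⟨hx, (mul_eq_zero.1 hgx).resolve_left (pow_ne_zero _ (by simp))⟩⟩
    · exact ⟨0, fun h => absurd h hj⟩
  choose q hq using hex
  have hqlt : ∀ i j, i < j → j ≤ N → q i < q j := by
    intro i j hij hj
    induction j, hij using Nat.le_induction with
    | base => exact (hq i (by omega)).1.2.trans (hq (i + 1) hj).1.1
    | succ k hk ih =>
      exact (ih (by omega)).trans ((hq k (by omega)).1.2.trans (hq (k + 1) hj).1.1)
  refine ⟨q, eq_prod_X_sub_C_of_monic hP hN ?_ fun i hi => (hq i (by omega)).2, fun i hi => ?_⟩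
  · intro i hi j hj h
    simp only [Finset.coe_range, Set.mem_Iio] at hi hj
    rcases lt_trichotomy i j with hij | hij | hij
    · exact absurd h (hqlt i j hij (by omega)).ne
    · exact hij
    · exact absurd h (hqlt j i hij (by omega)).ne'
  · have hRi : R (i + 1) = r i := by
      simp only [R]
      rw [if_neg (by omega), if_neg (by omega), Nat.add_sub_cancel]
    exact ⟨hRi ▸ (hq i (by omega)).1.2, hRi ▸ (hq (i + 1) (by omega)).1.1⟩

theorem lt_of_interlacing {m : ℕ} {s r : ℕ → ℝ} (h : ∀ i < m, r i < s i ∧ s i < r (i + 1)) :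
    ∀ i j, i < j → j < m + 1 → r i < r j := by
  intro i j hij hj
  induction j, hij using Nat.le_induction with
  | base => exact (h i (by omega)).1.trans (h i (by omega)).2
  | succ k hk ih => exact (ih (by omega)).trans ((h k (by omega)).1.trans (h k (by omega)).2)

theorem ne_of_interlacing {m : ℕ} {s r : ℕ → ℝ} (h : ∀ i < m, r i < s i ∧ s i < r (i + 1))
    {i j : ℕ} (hi : i < m) (hj : j < m + 1) : s i ≠ r j := by
  have hr := lt_of_interlacing h
  rcases Nat.lt_or_ge i j with hij | hij
  · rcases (Nat.succ_le_of_lt hij).lt_or_eq with hij | hij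
    · exact ((h i hi).2.trans (hr _ _ hij hj)).ne
    · exact hij ▸ (h i hi).2.ne
  · rcases hij.lt_or_eq with hij | hij
    · exact ((hr _ _ hij (by omega)).trans (h i hi).1).ne'
    · exact hij ▸ (h i hi).1.ne'

theorem sign_prod_of_interlacing {m : ℕ} {s r : ℕ → ℝ} (h : ∀ i < m, r i < s i ∧ s i < r (i + 1))
    {i : ℕ} (hi : i ≤ m) : 0 < (-1) ^ (m - i) * ∏ j ∈ Finset.range m, (r i - s j) := by
  have hr := lt_of_interlacing h
  have hr' : ∀ i j, i ≤ j → j < m + 1 → r i ≤ r j := fun i j hij hj => by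
    rcases hij.eq_or_lt with rfl | hij
    · exact le_rfl
    · exact (hr i j hij hj).le
  rw [← Finset.prod_range_mul_prod_Ico _ hi, mul_left_comm]
  refine mul_pos (Finset.prod_pos fun j hj => ?_) ?_
  · have hj := Finset.mem_range.1 hj
    exact sub_pos.2 ((h j (by omega)).2.trans_le (hr' (j + 1) i hj (by omega)))
  · rw [← Nat.card_Ico, ← Finset.prod_const, ← Finset.prod_mul_distrib]
    refine Finset.prod_pos fun j hj => ?_
    have hj := Finset.mem_Ico.1 hj
    have := (hr' i j hj.1 (by omega)).trans_lt (h j hj.2).1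
    linarith

/-- Monic real polynomials given by a three-term recurrence with positive coefficients `b`. -/
structure ThreeTermRecurrence (q : ℕ → ℝ[X]) (a b : ℕ → ℝ) : Prop where
  zero : q 0 = 1
  one : q 1 = X - C (a 0)
  add_two (m : ℕ) : q (m + 2) = (X - C (a (m + 1))) * q (m + 1) - C (b m) * q m
  pos (m : ℕ) : 0 < b m

theorem ThreeTermRecurrence.monic_and_natDegree {q : ℕ → ℝ[X]} {a b : ℕ → ℝ}
    (h : ThreeTermRecurrence q a b) (m : ℕ) : (q m).Monic ∧ (q m).natDegree = m := by
  induction m using Nat.twoStepInduction with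
  | zero => simp [h.zero]
  | one => exact h.one ▸ ⟨monic_X_sub_C _, natDegree_X_sub_C _⟩
  | more m h0 h1 =>
    have hm : ((X - C (a (m + 1))) * q (m + 1)).Monic := (monic_X_sub_C _).mul h1.1
    have hd : ((X - C (a (m + 1))) * q (m + 1)).natDegree = m + 2 := by
      rw [(monic_X_sub_C _).natDegree_mul h1.1, natDegree_X_sub_C, h1.2]; ring
    have hlt : (C (b m) * q m).degree < ((X - C (a (m + 1))) * q (m + 1)).degree := by
      refine degree_lt_degree (lt_of_le_of_lt (natDegree_C_mul_le _ _) ?_)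
      rw [hd, h0.2]; omega
    rw [h.add_two]
    exact ⟨hm.sub_of_left hlt, by rw [natDegree_sub_eq_left_of_natDegree_lt
      (by rw [hd]; exact (natDegree_C_mul_le _ _).trans_lt (by rw [h0.2]; omega)), hd]⟩

/-- The sign change argument for Sturm sequences: `q m` has `m` real roots, and the roots of `q m`
and `q (m + 1)` strictly interlace, because `q (m + 2)` and `q m` have opposite signs at the roots
of `q (m + 1)`. -/
theorem ThreeTermRecurrence.exists_roots {q : ℕ → ℝ[X]} {a b : ℕ → ℝ}
    (h : ThreeTermRecurrence q a b) :
    ∃ r : ℕ → ℕ → ℝ, (∀ m, q m = ∏ i ∈ Finset.range m, (X - C (r m i))) ∧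
      ∀ m, ∀ i < m, r (m + 1) i < r m i ∧ r m i < r (m + 1) (i + 1) := by
  -- the induction carries the roots of two consecutive polynomials
  let good : ℕ → (ℕ → ℝ) → (ℕ → ℝ) → Prop := fun m s r =>
    q m = ∏ i ∈ Finset.range m, (X - C (s i)) ∧
    q (m + 1) = ∏ i ∈ Finset.range (m + 1), (X - C (r i)) ∧
    ∀ i < m, r i < s i ∧ s i < r (i + 1)
  have step : ∀ m s r, good m s r → ∃ r', good (m + 1) r r' := by
    rintro m s r ⟨hs, hr, hsr⟩
    obtain ⟨r', h1, h2⟩ := exists_roots_of_alternating (h.monic_and_natDegree (m + 2)).1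
      (h.monic_and_natDegree (m + 2)).2 (lt_of_interlacing hsr) (fun i hi => by
        have hroot : (q (m + 1)).eval (r i) = 0 := by
          rw [hr, eval_prod]
          exact Finset.prod_eq_zero (Finset.mem_range.2 hi) (by simp)
        have hsign := sign_prod_of_interlacing hsr (Nat.lt_succ_iff.1 hi)
        have hm : (q m).eval (r i) = ∏ j ∈ Finset.range m, (r i - s j) := by
          rw [hs, eval_prod]; simp
        rw [← hm] at hsign
        rw [h.add_two, eval_sub, eval_mul, hroot, mul_zero, zero_sub, eval_mul, eval_C,
          show m + 1 - i = (m - i) + 1 by omega, pow_succ]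
        nlinarith [mul_pos (h.pos m) hsign])
    exact ⟨r', hr, h1, h2⟩
  have base : good 0 (fun _ => 0) (fun _ => a 0) := ⟨by simp [h.zero], by simp [h.one], by simp⟩
  let F : ∀ m, {p : (ℕ → ℝ) × (ℕ → ℝ) // good m p.1 p.2} := fun m =>
    Nat.rec ⟨(_, _), base⟩
      (fun m p => ⟨(p.1.2, (step m _ _ p.2).choose), (step m _ _ p.2).choose_spec⟩) m
  exact ⟨fun m => (F m).1.1, fun m => (F m).2.1, fun m => (F m).2.2.2⟩

/-! ### Orthonormal polynomials and the matrix of the multiplication operator -/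

section Moments

variable {ν : Measure ℝ} (hν : IsSuitable ν)

/-- The moment functional `p ↦ ∫ p dν` on real polynomials. -/
def moment : ℝ[X] →ₗ[ℝ] ℝ where
  toFun p := ∫ t, p.eval t ∂ν
  map_add' p q := by
    simp only [eval_add]
    exact integral_add (hν.integrable p) (hν.integrable q)
  map_smul' a p := by
    simp only [eval_smul, smul_eq_mul, RingHom.id_apply]
    exact integral_const_mul a _

variable {φ : ℕ → ℝ[X]} (hφ : IsOrthonormalPolys ν φ)

include hφ in
theorem moment_mul (j k : ℕ) : moment hν (φ j * φ k) = if j = k then 1 else 0 := by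
  rw [← hφ.integral_mul j k]
  simp [moment]

include hφ in
/-- Expansion of a polynomial in the orthonormal polynomials of smaller degree. -/
theorem eq_sum_moment {N : ℕ} {p : ℝ[X]} (hp : p.degree < N) :
    p = ∑ j ∈ Finset.range N, moment hν (p * φ j) • φ j := by
  let S : Polynomial.Sequence ℝ := ⟨φ, hφ.degree_eq⟩
  have hmem : p ∈ Submodule.span ℝ (S '' Set.Iio N) := by
    rw [S.span_degreeLT fun i _ => (leadingCoeff_ne_zero.2 (S.ne_zero i)).isUnit, mem_degreeLT]
    exact hp
  clear hp
  induction hmem using Submodule.span_induction with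
  | mem p hp =>
    obtain ⟨k, hk, rfl⟩ := hp
    change φ k = ∑ j ∈ Finset.range N, moment hν (φ k * φ j) • φ j
    simp only [moment_mul hν hφ, ite_smul, one_smul, zero_smul]
    rw [Finset.sum_ite_eq, if_pos (Finset.mem_range.2 hk)]
  | zero => simp
  | add p q _ _ hp hq =>
    nth_rw 1 [hp, hq]
    simp only [add_mul, map_add, add_smul, Finset.sum_add_distrib]
  | smul a p _ hp =>
    nth_rw 1 [hp]
    simp only [smul_mul_assoc, map_smul, smul_assoc, Finset.smul_sum]

include hφ in
theorem moment_mul_eq_zero {k : ℕ} {p : ℝ[X]} (hp : p.degree < k) :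
    moment hν (p * φ k) = 0 := by
  rw [eq_sum_moment hν hφ hp, Finset.sum_mul, map_sum]
  refine Finset.sum_eq_zero fun j hj => ?_
  rw [smul_mul_assoc, map_smul, moment_mul hν hφ, if_neg (Finset.mem_range.1 hj).ne, smul_zero]

variable (φ) in
/-- The matrix coefficients `∫ t φ_j φ_k dν` of multiplication by `t`. -/
def jacobiEntry (j k : ℕ) : ℝ := moment hν (X * φ j * φ k)

theorem jacobiEntry_comm (j k : ℕ) : jacobiEntry hν φ j k = jacobiEntry hν φ k j := by
  rw [jacobiEntry, jacobiEntry, mul_right_comm]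

include hφ

theorem degree_X_mul (k : ℕ) : (X * φ k).degree = ((k + 1 : ℕ) : WithBot ℕ) := by
  rw [degree_mul, degree_X, hφ.degree_eq, add_comm]; rfl

theorem jacobiEntry_eq_zero {j k : ℕ} (h : j + 1 < k) : jacobiEntry hν φ j k = 0 :=
  moment_mul_eq_zero hν hφ (by rw [degree_X_mul hφ]; exact_mod_cast h)

/-- The three-term recurrence of the orthonormal polynomials. -/
theorem X_mul_eq (k : ℕ) : X * φ (k + 1) = jacobiEntry hν φ (k + 1) (k + 2) • φ (k + 2) +
    jacobiEntry hν φ (k + 1) (k + 1) • φ (k + 1) + jacobiEntry hν φ k (k + 1) • φ k := by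
  have hdeg : (X * φ (k + 1)).degree < ((k + 3 : ℕ) : WithBot ℕ) := by
    rw [degree_X_mul hφ]; exact_mod_cast Nat.lt_succ_self _
  rw [eq_sum_moment hν hφ hdeg, Finset.sum_range_succ, Finset.sum_range_succ,
    Finset.sum_range_succ, Finset.sum_eq_zero]
  · change 0 + jacobiEntry hν φ (k + 1) k • φ k + jacobiEntry hν φ (k + 1) (k + 1) • φ (k + 1) +
      jacobiEntry hν φ (k + 1) (k + 2) • φ (k + 2) = _
    rw [jacobiEntry_comm hν (k + 1) k]
    ring
  · intro j hj
    change jacobiEntry hν φ (k + 1) j • φ j = 0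
    rw [jacobiEntry_comm, jacobiEntry_eq_zero hν hφ (by have := Finset.mem_range.1 hj; omega),
      zero_smul]

theorem X_mul_zero_eq : X * φ 0 = jacobiEntry hν φ 0 1 • φ 1 + jacobiEntry hν φ 0 0 • φ 0 := by
  have hdeg : (X * φ 0).degree < ((2 : ℕ) : WithBot ℕ) := by
    rw [degree_X_mul hφ]; exact_mod_cast Nat.lt_succ_self _
  rw [eq_sum_moment hν hφ hdeg, Finset.sum_range_succ, Finset.sum_range_succ, Finset.sum_range_zero,
    zero_add, add_comm]
  rfl

theorem leadingCoeff_ne (k : ℕ) : (φ k).leadingCoeff ≠ 0 := by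
  rw [Ne, leadingCoeff_eq_zero, ← degree_eq_bot, hφ.degree_eq]
  exact WithBot.coe_ne_bot

theorem natDegree_eq (k : ℕ) : (φ k).natDegree = k := natDegree_eq_of_degree_eq_some (hφ.degree_eq k)

/-- Comparison of the coefficients of `t ^ (k + 1)` in the recurrence for `t φ_k`: the off-diagonal
entries are ratios of leading coefficients, so they are nonzero and control the signs. -/
theorem jacobiEntry_mul_leadingCoeff (k : ℕ) :
    jacobiEntry hν φ k (k + 1) * (φ (k + 1)).leadingCoeff = (φ k).leadingCoeff := by
  have hc : ∀ j ≤ k, (φ j).coeff (k + 1) = 0 := fun j hj =>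
    coeff_eq_zero_of_natDegree_lt (by rw [natDegree_eq hφ]; omega)
  have h1 : (X * φ k).coeff (k + 1) = (φ k).leadingCoeff := by
    rw [coeff_X_mul, leadingCoeff, natDegree_eq hφ]
  rw [← h1, leadingCoeff, natDegree_eq hφ]
  cases k with
  | zero => rw [X_mul_zero_eq hν hφ]; simp [hc]
  | succ k => rw [X_mul_eq hν hφ]; simp [hc]

theorem jacobiEntry_succ_ne_zero (k : ℕ) : jacobiEntry hν φ k (k + 1) ≠ 0 := fun h => by
  have := jacobiEntry_mul_leadingCoeff hν hφ k
  rw [h, zero_mul] at this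
  exact leadingCoeff_ne hφ k this.symm

omit hφ in
variable (φ) in
/-- The monic orthogonal polynomial of degree `k`. -/
def monicPoly (k : ℕ) : ℝ[X] := C (φ k).leadingCoeff⁻¹ * φ k

theorem threeTermRecurrence_monicPoly : ThreeTermRecurrence (monicPoly φ)
    (fun k => jacobiEntry hν φ k k) (fun k => jacobiEntry hν φ k (k + 1) ^ 2) where
  zero := by
    obtain ⟨a, ha⟩ : ∃ a, φ 0 = C a := ⟨_, eq_C_of_natDegree_eq_zero (natDegree_eq hφ 0)⟩
    have h := leadingCoeff_ne hφ 0
    rw [monicPoly]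
    rw [ha, leadingCoeff_C] at h ⊢
    rw [← C_mul, inv_mul_cancel₀ h, C_1]
  one := by
    have h0 := X_mul_zero_eq hν hφ
    have hl := jacobiEntry_mul_leadingCoeff hν hφ 0
    have h := leadingCoeff_ne hφ 0
    have h1 := leadingCoeff_ne hφ 1
    obtain ⟨a, ha⟩ : ∃ a, φ 0 = C a := ⟨_, eq_C_of_natDegree_eq_zero (natDegree_eq hφ 0)⟩
    have hc : (φ 1).leadingCoeff⁻¹ = a⁻¹ * jacobiEntry hν φ 0 1 := by
      have ha0 : a = (φ 0).leadingCoeff := by rw [ha, leadingCoeff_C]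
      rw [ha0]
      field_simp
      linear_combination -hl
    have haa : C a⁻¹ * C a = (1 : ℝ[X]) := by
      rw [← C_mul, inv_mul_cancel₀ (by rintro rfl; simp [ha] at h), C_1]
    rw [monicPoly, hc, C_mul]
    simp only [smul_eq_C_mul, ha] at h0
    linear_combination -C a⁻¹ * h0 + (X - C (jacobiEntry hν φ 0 0)) * haa
  add_two k := by
    have h0 := X_mul_eq hν hφ k
    have hl := jacobiEntry_mul_leadingCoeff hν hφ k
    have hl1 := jacobiEntry_mul_leadingCoeff hν hφ (k + 1)
    have h := leadingCoeff_ne hφ k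
    have h1 := leadingCoeff_ne hφ (k + 1)
    have h2 := leadingCoeff_ne hφ (k + 2)
    have hc2 : (φ (k + 2)).leadingCoeff⁻¹ =
        (φ (k + 1)).leadingCoeff⁻¹ * jacobiEntry hν φ (k + 1) (k + 2) := by
      field_simp
      linear_combination -hl1
    have hc1 : jacobiEntry hν φ k (k + 1) ^ 2 * (φ k).leadingCoeff⁻¹ =
        (φ (k + 1)).leadingCoeff⁻¹ * jacobiEntry hν φ k (k + 1) := by
      field_simp
      linear_combination jacobiEntry hν φ k (k + 1) * hl
    have hc1' := congrArg (C : ℝ → ℝ[X]) hc1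
    rw [C_mul, C_mul] at hc1'
    simp only [smul_eq_C_mul] at h0
    simp only [monicPoly]
    rw [hc2, C_mul]
    linear_combination -C (φ (k + 1)).leadingCoeff⁻¹ * h0 + φ k * hc1'
  pos k := by
    have := jacobiEntry_succ_ne_zero hν hφ k
    positivity

/-- In the basis `φ_0, …, φ_{n-1}` the compressed multiplication operator has the real
entries `∫ t φ_i φ_j dν`. -/
theorem jacobiMatrix_apply (n : ℕ) (i j : Fin n) :
    jacobiMatrix hν hφ n i j = (jacobiEntry hν φ i j : ℂ) := by
  have hb : ∀ k, polyBasis hν hφ n k = polyVec hν hφ n k := fun k => by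
    rw [polyBasis, Module.Basis.mk_apply]
  have hrepr : ∀ (v : W hν n) (i : Fin n),
      (polyBasis hν hφ n).repr v i = inner ℂ (polyVec hν hφ n i) v := by
    intro v i
    conv_rhs => rw [← (polyBasis hν hφ n).sum_repr v]
    simp only [hb]
    rw [(orthonormal_polyVec hν hφ n).inner_right_fintype]
  rw [jacobiMatrix, LinearMap.toMatrix_apply, hrepr, hb]
  have hmul : (mulT ν).toFun (Submodule.inclusion (W_le_domain hν n) (polyVec hν hφ n j)) =
      polyL2 hν (toC (X * φ j)) := by
    refine MemLp.toLp_congr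
      (Submodule.inclusion (W_le_domain hν n) (polyVec hν hφ n j)).2 (hν.memLp _) ?_
    filter_upwards [(hν.memLp (toC (φ j))).coeFn_toLp] with t ht
    change (t : ℂ) * ((hν.memLp (toC (φ j))).toLp _ : L2 ν) t = _
    rw [ht]
    simp [toC]
  have hc : compress hν n (polyVec hν hφ n j) =
      (W hν n).orthogonalProjectionOnto (polyL2 hν (toC (X * φ j))) := by
    rw [← hmul]; rfl
  rw [hc, Submodule.inner_orthogonalProjectionOnto_eq_of_mem_left]
  change inner ℂ (polyL2 hν (toC (φ i))) _ = _
  rw [inner_polyL2, jacobiEntry_comm, jacobiEntry, mul_comm (X * φ j)]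
  simp [moment]

theorem signedMatrix_apply (n : ℕ) (ε : Fin n → ℤˣ) (i j : Fin n) :
    signedMatrix hν hφ n ε i j = (ε i : ℂ) * jacobiMatrix hν hφ n i j * (ε j : ℂ) := by
  rw [signedMatrix, jacobiMatrix, LinearMap.toMatrix_apply, LinearMap.toMatrix_apply, signedBasis,
    Module.Basis.repr_unitsSMul, Module.Basis.unitsSMul_apply, ← map_inv, Int.units_inv_eq_self]
  simp only [Units.smul_def, map_smul, Finsupp.smul_apply, smul_eq_mul]
  simp
  ring

end Moments

/-! ### Jacobi matrices and sign changes -/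

/-- The characteristic polynomials of the cutoffs of a Jacobi matrix satisfy a three-term
recurrence. -/
theorem charpoly_cutoff_add_two {n : ℕ} {y : Matrix (Fin n) (Fin n) ℂ} (hs : y.IsSymm)
    (hJ : IsJacobi y) {m : ℕ} (hm : m + 2 ≤ n) :
    (cutoff y (m + 2) hm).charpoly =
      (X - C (y ⟨m + 1, hm⟩ ⟨m + 1, hm⟩)) * (cutoff y (m + 1) (by omega)).charpoly -
        C (y ⟨m, by omega⟩ ⟨m + 1, hm⟩ ^ 2) * (cutoff y m (by omega)).charpoly := by
  refine Polynomial.funext fun z => ?_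
  set b := y ⟨m, by omega⟩ ⟨m + 1, hm⟩ with hb
  have hu : (fun i : Fin (m + 1) => cutoff y (m + 2) hm i.castSucc (Fin.last (m + 1))) =
      Pi.single (Fin.last m) b := by
    ext i
    induction i using Fin.lastCases with
    | last => rw [Pi.single_eq_same]; rfl
    | cast i =>
      rw [Pi.single_eq_of_ne (Fin.castSucc_lt_last i).ne]
      refine hJ.1 _ _ (Or.inl ?_)
      simp
  have hw : (fun i : Fin (m + 1) => cutoff y (m + 2) hm (Fin.last (m + 1)) i.castSucc) =
      Pi.single (Fin.last m) b := by
    rw [← hu]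
    ext i
    exact hs.apply _ _
  rw [eval_charpoly_succ, hu, hw]
  change (z - y ⟨m + 1, hm⟩ ⟨m + 1, hm⟩) * (cutoff y (m + 1) (by omega)).charpoly.eval z -
    Pi.single (Fin.last m) b ⬝ᵥ ((scalar (Fin (m + 1)) z - cutoff y (m + 1) (by omega)).adjugate *ᵥ
      Pi.single (Fin.last m) b) = _
  have hsub : (scalar (Fin (m + 1)) z - cutoff y (m + 1) (by omega)).submatrix
      (Fin.last m).succAbove (Fin.last m).succAbove =
      scalar (Fin m) z - cutoff y m (by omega) := by
    ext i j
    simp only [Fin.succAbove_last, submatrix_apply, Matrix.sub_apply, scalar_apply, diagonal_apply,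
      Fin.castSucc_inj]
    rfl
  rw [single_dotProduct, mulVec_single]
  simp only [Pi.smul_apply, Matrix.col_apply, MulOpposite.smul_eq_mul_unop, MulOpposite.unop_op,
    adjugate_fin_succ_eq_det_submatrix, hsub, eval_sub, eval_mul, eval_X, eval_C, eval_charpoly,
    Even.neg_one_pow ⟨_, rfl⟩]
  ring

theorem charpoly_cutoff_one {n : ℕ} (y : Matrix (Fin n) (Fin n) ℂ) (hn : 1 ≤ n) :
    (cutoff y 1 hn).charpoly = X - C (y ⟨0, hn⟩ ⟨0, hn⟩) := by
  simp [charpoly, cutoff]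
  rfl

theorem charpoly_cutoff_zero {n : ℕ} (y : Matrix (Fin n) (Fin n) ℂ) :
    (cutoff y 0 n.zero_le).charpoly = 1 := by
  simp [charpoly]

/-- The diagonal entries and the squares of the off-diagonal entries of a symmetric Jacobi matrix
are determined by the characteristic polynomials of the cutoffs. -/
theorem entries_eq_of_charpoly_cutoff_eq {n : ℕ} {x y : Matrix (Fin n) (Fin n) ℂ}
    (hxs : x.IsSymm) (hx : IsJacobi x) (hys : y.IsSymm) (hy : IsJacobi y)
    (h : ∀ (m : ℕ) (hm : m ≤ n), (cutoff y m hm).charpoly = (cutoff x m hm).charpoly) :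
    (∀ i, y i i = x i i) ∧
      ∀ (m : ℕ) (hm : m + 1 < n), y ⟨m, by omega⟩ ⟨m + 1, hm⟩ ^ 2 =
        x ⟨m, by omega⟩ ⟨m + 1, hm⟩ ^ 2 := by
  have key : ∀ (m : ℕ) (hm : m + 2 ≤ n), y ⟨m + 1, hm⟩ ⟨m + 1, hm⟩ = x ⟨m + 1, hm⟩ ⟨m + 1, hm⟩ ∧
      y ⟨m, by omega⟩ ⟨m + 1, hm⟩ ^ 2 = x ⟨m, by omega⟩ ⟨m + 1, hm⟩ ^ 2 := by
    intro m hm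
    have h2 := h (m + 2) hm
    rw [charpoly_cutoff_add_two hys hy, charpoly_cutoff_add_two hxs hx, h (m + 1) (by omega),
      h m (by omega)] at h2
    set p := (cutoff x (m + 1) (by omega)).charpoly with hp
    set q := (cutoff x m (by omega)).charpoly with hq
    have hpm : p.coeff (m + 1) = 1 := by
      have := (charpoly_monic (cutoff x (m + 1) (by omega))).coeff_natDegree
      rwa [charpoly_natDegree_eq_dim, Fintype.card_fin] at this
    have hqd : q.natDegree = m := by
      rw [hq, charpoly_natDegree_eq_dim, Fintype.card_fin]
    have hqm : q.coeff m = 1 := by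
      have := (charpoly_monic (cutoff x m (by omega))).coeff_natDegree
      rwa [charpoly_natDegree_eq_dim, Fintype.card_fin] at this
    have h3 : C (x ⟨m + 1, hm⟩ ⟨m + 1, hm⟩ - y ⟨m + 1, hm⟩ ⟨m + 1, hm⟩) * p =
        C (y ⟨m, by omega⟩ ⟨m + 1, hm⟩ ^ 2 - x ⟨m, by omega⟩ ⟨m + 1, hm⟩ ^ 2) * q := by
      rw [C_sub, C_sub]
      linear_combination h2
    have hd : y ⟨m + 1, hm⟩ ⟨m + 1, hm⟩ = x ⟨m + 1, hm⟩ ⟨m + 1, hm⟩ := by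
      have := congrArg (coeff · (m + 1)) h3
      simp only [coeff_C_mul, hpm, mul_one] at this
      rw [coeff_eq_zero_of_natDegree_lt (by rw [hqd]; omega), mul_zero] at this
      exact (sub_eq_zero.1 this).symm
    refine ⟨hd, ?_⟩
    have := congrArg (coeff · m) h3
    simp only [hd, sub_self, C_0, zero_mul, coeff_zero, coeff_C_mul, hqm, mul_one] at this
    exact sub_eq_zero.1 this.symm
  refine ⟨?_, fun m hm => (key m hm).2⟩
  rintro ⟨i, hi⟩
  cases i with
  | zero =>
    have := h 1 hi
    rw [charpoly_cutoff_one, charpoly_cutoff_one] at this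
    exact C_injective (sub_right_injective this)
  | succ i => exact (key i hi).1

/-- The matrix `D y D` for the diagonal matrix `D` of the signs `ε`. -/
def signConj {n : ℕ} (ε : Fin n → ℤˣ) (y : Matrix (Fin n) (Fin n) ℂ) : Matrix (Fin n) (Fin n) ℂ :=
  of fun i j => (ε i : ℂ) * y i j * (ε j : ℂ)

theorem intCast_unit_mul_self (u : ℤˣ) : ((u : ℤ) : ℂ) * ((u : ℤ) : ℂ) = 1 := by
  rw [← Int.cast_mul, ← Units.val_mul, Int.units_mul_self]; simp

theorem intCast_unit_ne_zero (u : ℤˣ) : ((u : ℤ) : ℂ) ≠ 0 :=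
  left_ne_zero_of_mul_eq_one (intCast_unit_mul_self u)

theorem isSymm_signConj {n : ℕ} (ε : Fin n → ℤˣ) {y : Matrix (Fin n) (Fin n) ℂ} (hy : y.IsSymm) :
    (signConj ε y).IsSymm := by
  refine IsSymm.ext fun i j => ?_
  simp only [signConj, of_apply, hy.apply i j]
  ring

theorem isJacobi_signConj {n : ℕ} (ε : Fin n → ℤˣ) {y : Matrix (Fin n) (Fin n) ℂ}
    (hy : IsJacobi y) : IsJacobi (signConj ε y) := by
  refine ⟨fun i j h => ?_, fun i j h => ?_⟩
  · simp [signConj, hy.1 i j h]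
  · exact mul_ne_zero (mul_ne_zero (intCast_unit_ne_zero _) (hy.2 i j h)) (intCast_unit_ne_zero _)

theorem charpoly_signConj {n : ℕ} (ε : Fin n → ℤˣ) (y : Matrix (Fin n) (Fin n) ℂ) :
    (signConj ε y).charpoly = y.charpoly := by
  let D : Matrix (Fin n) (Fin n) ℂ := diagonal fun i => (ε i : ℂ)
  have hD : D * D = 1 := by
    simp only [D, diagonal_mul_diagonal, intCast_unit_mul_self, diagonal_one]
  have h : signConj ε y = D * (y * D) := by
    ext i j
    simp [signConj, D, mul_assoc]
  rw [h, charpoly_mul_comm, Matrix.mul_assoc, hD, Matrix.mul_one]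

theorem charpoly_cutoff_signConj {n : ℕ} (ε : Fin n → ℤˣ) (y : Matrix (Fin n) (Fin n) ℂ) (m : ℕ)
    (hm : m ≤ n) : (cutoff (signConj ε y) m hm).charpoly = (cutoff y m hm).charpoly :=
  charpoly_signConj (fun i => ε (Fin.castLE hm i)) (cutoff y m hm)

/-- Two symmetric Jacobi matrices whose cutoffs have the same characteristic polynomials differ by
a sign change of the basis vectors, which may be taken to fix the first one. -/
theorem exists_signConj_eq {n : ℕ} (hn : 0 < n) {x y : Matrix (Fin n) (Fin n) ℂ}
    (hxs : x.IsSymm) (hx : IsJacobi x) (hys : y.IsSymm) (hy : IsJacobi y)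
    (h : ∀ (m : ℕ) (hm : m ≤ n), (cutoff y m hm).charpoly = (cutoff x m hm).charpoly) :
    ∃ ε : Fin n → ℤˣ, ε ⟨0, hn⟩ = 1 ∧ signConj ε x = y := by
  obtain ⟨hdiag, hsq⟩ := entries_eq_of_charpoly_cutoff_eq hxs hx hys hy h
  have hσ : ∀ m, ∃ u : ℤˣ, ∀ hm : m + 1 < n, y ⟨m, by omega⟩ ⟨m + 1, hm⟩ =
      (u : ℂ) * x ⟨m, by omega⟩ ⟨m + 1, hm⟩ := by
    intro m
    by_cases hm : m + 1 < n
    · rcases sq_eq_sq_iff_eq_or_eq_neg.1 (hsq m hm) with h | h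
      · exact ⟨1, fun _ => by simp [h]⟩
      · exact ⟨-1, fun _ => by simp [h]⟩
    · exact ⟨1, fun h => absurd h hm⟩
  choose σ hσ using hσ
  -- `ε (m + 1) = σ m * ε m` makes the entries next to the diagonal agree
  let ε : Fin n → ℤˣ := fun i => ∏ j ∈ Finset.range i, σ j
  have hadj : ∀ (m : ℕ) (hm : m + 1 < n),
      signConj ε x ⟨m, by omega⟩ ⟨m + 1, hm⟩ = y ⟨m, by omega⟩ ⟨m + 1, hm⟩ := by
    intro m hm
    rw [hσ m hm]
    simp only [signConj, of_apply, ε, Finset.prod_range_succ, Units.val_mul, Int.cast_mul]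
    linear_combination (σ m : ℂ) * x ⟨m, by omega⟩ ⟨m + 1, hm⟩ *
      intCast_unit_mul_self (∏ j ∈ Finset.range m, σ j)
  refine ⟨ε, by simp [ε], ?_⟩
  ext ⟨i, hi⟩ ⟨j, hj⟩
  by_cases hij : i = j
  · subst hij
    rw [hdiag]
    simp only [signConj, of_apply]
    linear_combination x ⟨i, hi⟩ ⟨i, hi⟩ * intCast_unit_mul_self (ε ⟨i, hi⟩)
  by_cases h1 : i + 1 = j
  · subst h1; exact hadj i hj
  by_cases h2 : j + 1 = i
  · subst h2
    rw [← (isSymm_signConj ε hxs).apply, ← hys.apply]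
    exact hadj j hi
  · have hfar : i + 1 < j ∨ j + 1 < i := by omega
    rw [hy.1 _ _ hfar, (isJacobi_signConj ε hx).1 _ _ hfar]

theorem signConj_injOn {n : ℕ} (hn : 0 < n) {x : Matrix (Fin n) (Fin n) ℂ} (hx : IsJacobi x) :
    Set.InjOn (fun ε => signConj ε x) {ε | ε ⟨0, hn⟩ = 1} := by
  intro ε hε ε' hε' h
  ext ⟨i, hi⟩ : 1
  induction i with
  | zero => exact hε.trans hε'.symm
  | succ i ih =>
    have hi' := ih (by omega)
    have he := congrFun (congrFun h ⟨i, by omega⟩) ⟨i + 1, hi⟩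
    simp only [signConj, of_apply, hi'] at he
    have := mul_left_cancel₀ (mul_ne_zero (intCast_unit_ne_zero _)
      (hx.2 ⟨i, by omega⟩ ⟨i + 1, hi⟩ (Or.inl rfl))) he
    exact Units.ext (Int.cast_injective this)

/-- Signs changing a matrix with positive adjacent diagonals into another one are constant. -/
theorem signConj_eq_self_of_pos {n : ℕ} (hn : 0 < n) {x : Matrix (Fin n) (Fin n) ℂ}
    (hx : HasPosAdjacentDiagonals x) {ε : Fin n → ℤˣ} (hε : ε ⟨0, hn⟩ = 1)
    (hy : HasPosAdjacentDiagonals (signConj ε x)) : signConj ε x = x := by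
  have h1 : ∀ (i : ℕ) (hi : i < n), ε ⟨i, hi⟩ = 1 := by
    intro i
    induction i with
    | zero => exact fun _ => hε
    | succ i ih =>
      intro hi
      refine (Int.units_eq_one_or _).resolve_right fun hneg => ?_
      have h := (hy ⟨i, by omega⟩ ⟨i + 1, hi⟩ (Or.inl rfl)).1
      have h' := (hx ⟨i, by omega⟩ ⟨i + 1, hi⟩ (Or.inl rfl)).1
      simp only [signConj, of_apply, ih, hneg] at h
      simp at h
      linarith
  ext i j
  simp [signConj, h1]

theorem ncard_signs {n : ℕ} (hn : 0 < n) : {ε : Fin n → ℤˣ | ε ⟨0, hn⟩ = 1}.ncard = 2 ^ (n - 1) := by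
  obtain ⟨k, rfl⟩ : ∃ k, n = k + 1 := ⟨n - 1, by omega⟩
  have : {ε : Fin (k + 1) → ℤˣ | ε ⟨0, hn⟩ = 1} = Set.range fun δ : Fin k → ℤˣ =>
      (Fin.cons 1 δ : Fin (k + 1) → ℤˣ) := by
    ext ε
    constructor
    · intro h
      exact ⟨Fin.tail ε, funext fun i => Fin.cases (Eq.symm h) (fun _ => rfl) i⟩
    · rintro ⟨δ, rfl⟩
      rfl
  rw [this, ← Set.image_univ, 
    Set.ncard_image_of_injective _ (Fin.cons_right_injective (α := fun _ => ℤˣ) 1),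
    Set.ncard_univ]
  simp

/-! ### Fibres of `Phi` and ordered tuples of roots -/

theorem paramPoly_Phi {n : ℕ} (x : Matrix (Fin n) (Fin n) ℂ) (m : Fin n) :
    paramPoly (Phi x) m = (cutoff x ((m : ℕ) + 1) m.isLt).charpoly := by
  have h := (charpoly_monic (cutoff x ((m : ℕ) + 1) m.isLt)).as_sum
  rw [charpoly_natDegree_eq_dim, Fintype.card_fin] at h
  refine Eq.trans ?_ h.symm
  rw [paramPoly, Finset.sum_range]
  refine congrArg (X ^ ((m : ℕ) + 1) + ·) (Finset.sum_congr rfl fun k _ => ?_)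
  simp only [Phi]
  rw [← mul_assoc, ← pow_add, Even.neg_one_pow ⟨_, rfl⟩, one_mul]

/-- The fibre of `Phi` through `x` prescribes exactly the characteristic polynomials of the cutoffs.
The size `0` may be included, as that characteristic polynomial is always `1`. -/
theorem mem_fiber_Phi {n : ℕ} {x y : Matrix (Fin n) (Fin n) ℂ} :
    y ∈ fiber (Phi x) ↔
      ∀ (m : ℕ) (hm : m ≤ n), (cutoff y m hm).charpoly = (cutoff x m hm).charpoly := by
  constructor
  · intro h m hm
    cases m with
    | zero => rw [charpoly_cutoff_zero, charpoly_cutoff_zero]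
    | succ m =>
      rw [← paramPoly_Phi y ⟨m, hm⟩, ← paramPoly_Phi x ⟨m, hm⟩, show Phi y = Phi x from h]
  · intro h
    refine funext fun i => ?_
    rw [Phi, Phi, h]

theorem mem_orderedRoots {p : ℂ[X]} {z : ℂ} : z ∈ orderedRoots p ↔ z ∈ p.roots := by
  simp only [orderedRoots, List.mem_map, Multiset.mem_sort, Multiset.mem_map]
  constructor
  · rintro ⟨_, ⟨w, hw, rfl⟩, rfl⟩
    exact hw
  · exact fun h => ⟨_, ⟨z, h, rfl⟩, rfl⟩

theorem mem_eigTuple {n : ℕ} {x : Matrix (Fin n) (Fin n) ℂ} {m : ℕ} {hm : m ≤ n} {z : ℂ} :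
    z ∈ eigTuple x m hm ↔ (cutoff x m hm).charpoly.eval z = 0 := by
  rw [eigTuple, mem_orderedRoots, mem_roots (charpoly_monic _).ne_zero, IsRoot]

/-- The lexicographic order of real roots is the order of the reals. -/
theorem orderedRoots_prod {N : ℕ} {r : ℕ → ℝ} (hr : ∀ i j, i < j → j < N → r i < r j) :
    orderedRoots (∏ i ∈ Finset.range N, (X - C (r i : ℂ))) =
      (List.range N).map fun i => (r i : ℂ) := by
  have hroots : (∏ i ∈ Finset.range N, (X - C (r i : ℂ))).roots =
      ((List.range N).map fun i => (r i : ℂ) : Multiset ℂ) := by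
    rw [roots_prod _ _ (Finset.prod_ne_zero_iff.2 fun i _ => X_sub_C_ne_zero _)]
    simp only [roots_X_sub_C, Multiset.bind_singleton]
    rfl
  rw [orderedRoots, hroots, Multiset.map_coe, Multiset.coe_sort]
  rw [List.mergeSort_eq_self]
  · simp only [List.map_map]
    refine List.map_congr_left fun i _ => ?_
    apply Complex.ext <;> simp
  · rw [List.map_map, List.pairwise_map]
    refine List.pairwise_lt_range.imp_of_mem fun {i j} _ hj hij => ?_
    simp [Prod.Lex.toLex_le_toLex, hr i j hij (List.mem_range.1 hj)]

theorem mu_eq_of_paramPoly {n : ℕ} {c : ParamIdx n → ℂ} {m : Fin n} {r : ℕ → ℝ}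
    (hr : ∀ i j, i < j → j < (m : ℕ) + 1 → r i < r j)
    (h : paramPoly c m = ∏ i ∈ Finset.range ((m : ℕ) + 1), (X - C (r i : ℂ)))
    (k : Fin ((m : ℕ) + 1)) : mu c m k = r k := by
  simp [mu, h, orderedRoots_prod hr]

/-! ### The Jacobi matrix of the measure -/

section JacobiMatrix

variable {ν : Measure ℝ} (hν : IsSuitable ν) {φ : ℕ → ℝ[X]} (hφ : IsOrthonormalPolys ν φ)

theorem signedMatrix_eq_signConj (n : ℕ) :
    signedMatrix hν hφ n = fun ε => signConj ε (jacobiMatrix hν hφ n) := by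
  ext ε i j
  rw [signedMatrix_apply]
  rfl

theorem isSymm_jacobiMatrix (n : ℕ) : (jacobiMatrix hν hφ n).IsSymm :=
  IsSymm.ext fun i j => by rw [jacobiMatrix_apply, jacobiMatrix_apply, jacobiEntry_comm]

theorem isJacobi_jacobiMatrix (n : ℕ) : IsJacobi (jacobiMatrix hν hφ n) := by
  refine ⟨fun i j h => ?_, fun i j h => ?_⟩
  · rw [jacobiMatrix_apply]
    rcases h with h | h
    · rw [jacobiEntry_eq_zero hν hφ h, Complex.ofReal_zero]
    · rw [jacobiEntry_comm, jacobiEntry_eq_zero hν hφ h, Complex.ofReal_zero]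
  · rw [jacobiMatrix_apply, Complex.ofReal_ne_zero]
    rcases h with h | h
    · rw [← h]; exact jacobiEntry_succ_ne_zero hν hφ _
    · rw [← h, jacobiEntry_comm]; exact jacobiEntry_succ_ne_zero hν hφ _

/-- The characteristic polynomials of the cutoffs and the monic orthogonal polynomials satisfy the
same three-term recurrence. -/
theorem charpoly_cutoff_jacobiMatrix {n : ℕ} (m : ℕ) (hm : m ≤ n) :
    (cutoff (jacobiMatrix hν hφ n) m hm).charpoly = toC (monicPoly φ m) := by
  have hrec := threeTermRecurrence_monicPoly hν hφ
  induction m using Nat.twoStepInduction with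
  | zero => rw [charpoly_cutoff_zero, hrec.zero, toC, Polynomial.map_one]
  | one =>
    rw [charpoly_cutoff_one, hrec.one, jacobiMatrix_apply]
    simp
  | more m h0 h1 =>
    rw [charpoly_cutoff_add_two (isSymm_jacobiMatrix hν hφ n) (isJacobi_jacobiMatrix hν hφ n),
      h0, h1, hrec.add_two, jacobiMatrix_apply, jacobiMatrix_apply]
    simp

include hφ in
theorem eval_toC_monicPoly_eq_zero {m : ℕ} {z : ℂ} :
    (toC (monicPoly φ m)).eval z = 0 ↔ (toC (φ m)).eval z = 0 := by
  simp [monicPoly, leadingCoeff_ne hφ m, toC]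

theorem hasPosAdjacentDiagonals_jacobiMatrix (h : ∀ k, 0 < (φ k).leadingCoeff) (n : ℕ) :
    HasPosAdjacentDiagonals (jacobiMatrix hν hφ n) := by
  have hpos : ∀ k, 0 < jacobiEntry hν φ k (k + 1) := fun k =>
    pos_of_mul_pos_left ((jacobiEntry_mul_leadingCoeff hν hφ k).symm ▸ h k) (h (k + 1)).le
  intro i j hij
  rw [jacobiMatrix_apply, Complex.ofReal_re, Complex.ofReal_im]
  refine ⟨?_, rfl⟩
  rcases hij with h | h
  · rw [← h]; exact hpos _
  · rw [← h, jacobiEntry_comm]; exact hpos _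

end JacobiMatrix

theorem isInterlacing_of_roots {n : ℕ} {c : ParamIdx n → ℂ} {r : ℕ → ℕ → ℝ}
    (hr : ∀ m, ∀ i < m, r (m + 1) i < r m i ∧ r m i < r (m + 1) (i + 1))
    (hc : ∀ m : Fin n, paramPoly c m =
      ∏ i ∈ Finset.range ((m : ℕ) + 1), (X - C (r ((m : ℕ) + 1) i : ℂ))) :
    IsInterlacing c := by
  have hmu : ∀ (m : Fin n) (k : Fin ((m : ℕ) + 1)), mu c m k = r ((m : ℕ) + 1) k := fun m k =>
    mu_eq_of_paramPoly (lt_of_interlacing (hr m)) (hc m) k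
  refine ⟨fun m k => by rw [hmu, Complex.ofReal_im], fun m hm k => ?_⟩
  have h := hr (m + 1) k k.isLt
  rw [hmu, hmu, hmu]
  exact h

end OrthoJacobi

end

theorem theorem0p14 (ν : Measure ℝ) (hν : OrthoJacobi.IsSuitable ν)
    (φ : ℕ → ℝ[X]) (hφ : OrthoJacobi.IsOrthonormalPolys ν φ)
    (n : ℕ) (hn : 0 < n)
    (x : Matrix (Fin n) (Fin n) ℂ) (hx : x = OrthoJacobi.jacobiMatrix hν hφ n)
    (c : OrthoJacobi.ParamIdx n → ℂ) (hc : c = OrthoJacobi.Phi x) :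
    -- `c` is interlacing, and `x` is a real symmetric Jacobi matrix
    OrthoJacobi.IsInterlacing c ∧
    (∀ i j, (x i j).im = 0) ∧
    x ∈ OrthoJacobi.fiberSymm c ∧
    OrthoJacobi.IsJacobi x ∧
    -- the Jacobi matrices among the symmetric matrices in the fibre
    (OrthoJacobi.fiberSymm c).ncard = 2 ^ (n * (n - 1) / 2) ∧
    {y | y ∈ OrthoJacobi.fiberSymm c ∧ OrthoJacobi.IsJacobi y}.ncard = 2 ^ (n - 1) ∧
    {y | y ∈ OrthoJacobi.fiberSymm c ∧ OrthoJacobi.IsJacobi y} =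
      Set.range (OrthoJacobi.signedMatrix hν hφ n) ∧
    Set.BijOn (OrthoJacobi.signedMatrix hν hφ n) {ε | ε ⟨0, hn⟩ = 1}
      {y | y ∈ OrthoJacobi.fiberSymm c ∧ OrthoJacobi.IsJacobi y} ∧
    -- characteristic polynomials and zeros
    (∀ (m : ℕ) (hm : m ≤ n), 1 ≤ m →
      (OrthoJacobi.cutoff x m hm).charpoly =
          OrthoJacobi.toC (C (φ m).leadingCoeff⁻¹ * φ m) ∧
        {z | z ∈ OrthoJacobi.eigTuple x m hm} = {z | (OrthoJacobi.toC (φ m)).eval z = 0}) ∧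
    -- for positive leading coefficients, `x` is the unique matrix with positive adjacent diagonals
    ((∀ k, 0 < (φ k).leadingCoeff) →
      OrthoJacobi.HasPosAdjacentDiagonals x ∧
      (∀ y ∈ OrthoJacobi.fiberSymm c, OrthoJacobi.IsJacobi y →
        OrthoJacobi.HasPosAdjacentDiagonals y → y = x) ∧
      ∀ y : Matrix (Fin n) (Fin n) ℂ, y.IsSymm → OrthoJacobi.IsJacobi y →
        OrthoJacobi.HasPosAdjacentDiagonals y →
        (∀ (m : ℕ) (hm : m ≤ n), 1 ≤ m →
          {z | z ∈ OrthoJacobi.eigTuple y m hm} = {z | (OrthoJacobi.toC (φ m)).eval z = 0}) →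
        y = x) := by
  have hxs : x.IsSymm := hx ▸ OrthoJacobi.isSymm_jacobiMatrix hν hφ n
  have hxJ : OrthoJacobi.IsJacobi x := hx ▸ OrthoJacobi.isJacobi_jacobiMatrix hν hφ n
  have hxp : ∀ (m : ℕ) (hm : m ≤ n), (OrthoJacobi.cutoff x m hm).charpoly =
      OrthoJacobi.toC (OrthoJacobi.monicPoly φ m) := fun m hm =>
    hx ▸ OrthoJacobi.charpoly_cutoff_jacobiMatrix hν hφ m hm
  have hsigned : OrthoJacobi.signedMatrix hν hφ n = fun ε => OrthoJacobi.signConj ε x :=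
    hx ▸ OrthoJacobi.signedMatrix_eq_signConj hν hφ n
  have hrec := OrthoJacobi.threeTermRecurrence_monicPoly hν hφ
  obtain ⟨r, hrp, hr⟩ := hrec.exists_roots
  have hrlt : ∀ m i j, i < j → j < m → r m i < r m j := by
    intro m
    cases m with
    | zero => exact fun _ _ _ h => absurd h (Nat.not_lt_zero _)
    | succ m => exact OrthoJacobi.lt_of_interlacing (hr m)
  have hrinj : ∀ m, Set.InjOn (r m) (Finset.range m) := fun m =>
    StrictMonoOn.injOn fun i _ j hj hij => hrlt m i j hij (Finset.mem_range.1 hj)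
  have hrC : ∀ m, OrthoJacobi.toC (OrthoJacobi.monicPoly φ m) =
      ∏ i ∈ Finset.range m, (X - C (r m i : ℂ)) := fun m => by
    rw [hrp m, OrthoJacobi.toC, Polynomial.map_prod]
    simp
  have hrroot : ∀ m, ∀ i < m,
      (OrthoJacobi.toC (OrthoJacobi.monicPoly φ m)).eval (r m i : ℂ) = 0 := fun m i hi => by
    rw [hrC, eval_prod]
    exact Finset.prod_eq_zero (Finset.mem_range.2 hi) (by simp)
  have hzeros : ∀ (y : Matrix (Fin n) (Fin n) ℂ) (m : ℕ) (hm : m ≤ n),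
      (OrthoJacobi.cutoff y m hm).charpoly = OrthoJacobi.toC (OrthoJacobi.monicPoly φ m) →
      {z | z ∈ OrthoJacobi.eigTuple y m hm} = {z | (OrthoJacobi.toC (φ m)).eval z = 0} := by
    intro y m hm h
    ext z
    rw [Set.mem_ofPred_eq, Set.mem_ofPred_eq, OrthoJacobi.mem_eigTuple, h,
      OrthoJacobi.eval_toC_monicPoly_eq_zero hφ]
  have hmem : ∀ y, y ∈ OrthoJacobi.fiberSymm c ↔ (∀ (m : ℕ) (hm : m ≤ n),
      (OrthoJacobi.cutoff y m hm).charpoly = (OrthoJacobi.cutoff x m hm).charpoly) ∧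
        y.IsSymm := fun y => by
    rw [hc, OrthoJacobi.fiberSymm, Set.mem_ofPred_eq, OrthoJacobi.mem_fiber_Phi]
  have hfiber : OrthoJacobi.fiberSymm c =
      OrthoJacobi.symmWithCharpolys (fun m => OrthoJacobi.toC (OrthoJacobi.monicPoly φ m)) n := by
    ext y
    rw [hmem, and_comm]
    simp only [hxp]
    rfl
  have hbij : Set.BijOn (OrthoJacobi.signedMatrix hν hφ n) {ε | ε ⟨0, hn⟩ = 1}
      {y | y ∈ OrthoJacobi.fiberSymm c ∧ OrthoJacobi.IsJacobi y} := by
    rw [hsigned]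
    refine ⟨fun ε _ => ⟨(hmem _).2 ⟨OrthoJacobi.charpoly_cutoff_signConj ε x,
      OrthoJacobi.isSymm_signConj ε hxs⟩, OrthoJacobi.isJacobi_signConj ε hxJ⟩,
      OrthoJacobi.signConj_injOn hn hxJ, ?_⟩
    rintro y ⟨hy, hyJ⟩
    obtain ⟨hyp, hys⟩ := (hmem y).1 hy
    exact OrthoJacobi.exists_signConj_eq hn hxs hxJ hys hyJ hyp
  refine ⟨?_, ?_, (hmem x).2 ⟨fun _ _ => rfl, hxs⟩, hxJ, ?_, ?_, ?_, hbij, ?_, ?_⟩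
  · refine OrthoJacobi.isInterlacing_of_roots hr fun m => ?_
    rw [hc, OrthoJacobi.paramPoly_Phi, hxp, hrC]
  · intro i j
    rw [hx, OrthoJacobi.jacobiMatrix_apply, Complex.ofReal_im]
  · rw [hfiber]
    refine OrthoJacobi.ncard_symmWithCharpolys
      (fun m => (hrec.monic_and_natDegree m).1.map _)
      (fun m => by rw [natDegree_map, (hrec.monic_and_natDegree m).2])
      (fun m i => (r m i : ℂ)) (fun m i j h => ?_) (fun m i => hrroot m i i.isLt)
      (fun m i => ?_) n
    · exact Fin.ext (hrinj m (by simp) (by simp) (Complex.ofReal_injective h))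
    · change (OrthoJacobi.toC _).eval _ ≠ 0
      rw [hrC, eval_prod, Finset.prod_ne_zero_iff]
      intro j hj
      rw [eval_sub, eval_X, eval_C, sub_ne_zero, Ne, Complex.ofReal_inj]
      exact OrthoJacobi.ne_of_interlacing (hr m) i.isLt (Finset.mem_range.1 hj)
  · rw [← hbij.image_eq, hbij.injOn.ncard_image, OrthoJacobi.ncard_signs]
  · refine Set.Subset.antisymm ?_ ?_
    · rw [← hbij.image_eq]
      exact Set.image_subset_range _ _
    · rw [hsigned]
      rintro _ ⟨ε, rfl⟩
      exact ⟨(hmem _).2 ⟨OrthoJacobi.charpoly_cutoff_signConj ε x,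
        OrthoJacobi.isSymm_signConj ε hxs⟩, OrthoJacobi.isJacobi_signConj ε hxJ⟩
  · exact fun m hm _ => ⟨hxp m hm, hzeros x m hm (hxp m hm)⟩
  · intro hpos
    have hxpos : OrthoJacobi.HasPosAdjacentDiagonals x :=
      hx ▸ OrthoJacobi.hasPosAdjacentDiagonals_jacobiMatrix hν hφ hpos n
    have huniq : ∀ y ∈ OrthoJacobi.fiberSymm c, OrthoJacobi.IsJacobi y →
        OrthoJacobi.HasPosAdjacentDiagonals y → y = x := by
      intro y hy hyJ hypos
      obtain ⟨hyp, hys⟩ := (hmem y).1 hy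
      obtain ⟨ε, hε, rfl⟩ := OrthoJacobi.exists_signConj_eq hn hxs hxJ hys hyJ hyp
      exact OrthoJacobi.signConj_eq_self_of_pos hn hxpos hε hypos
    refine ⟨hxpos, huniq, fun y hys hyJ hypos hset => huniq y ((hmem y).2 ⟨fun m hm => ?_, hys⟩)
      hyJ hypos⟩
    rcases Nat.eq_zero_or_pos m with rfl | hm0
    · rw [OrthoJacobi.charpoly_cutoff_zero, OrthoJacobi.charpoly_cutoff_zero]
    -- the `m` zeros of `φ m` are distinct, so they are all the eigenvalues, each of them simple
    · rw [hxp, hrC]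
      refine OrthoJacobi.eq_prod_X_sub_C_of_monic (Matrix.charpoly_monic _) (by simp)
        (Complex.ofReal_injective.comp_injOn (hrinj m)) fun i hi => ?_
      rw [← OrthoJacobi.mem_eigTuple]
      have h0 := (OrthoJacobi.eval_toC_monicPoly_eq_zero hφ).1 (hrroot m i hi)
      exact (hset m hm hm0).symm.subset h0
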